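/- Throughout, Hilbert spaces are complex, $\hat\otimes$ denotes the completed Hilbert space tensor product, and equality of Hilbert spaces embedded in a common Hilbert space means equality as vector spaces with equivalent norms. For a self-adjoint operator $A$ in a Hilbert space $H$ and $s\ge 0$ let $H^s(A)=\mathcal D((I+A^2)^{s/2})=\mathcal D(|A|^s)$, with scalar product $\langle (I+A^2)^{s/2}x,(I+A^2)^{s/2}y\rangle$. A self-adjoint operator $A$ in $H$ generates a family $(H^s)_{s\ge0}$ of Hilbert spaces continuously embedded in $H$ if $H^s=H^s(A)$ for all $s\ge 0$. A family $(H^s)_{s\ge 0}$ of Hilbert spaces continuously embedded in $H$ is an interpolation scale if (i) $H^{s'}\hookrightarrow H^s$ continuously for $s'\ge s$; (ii) $[H^s,H^t]_\theta=H^{\theta t+(1-\theta)s}$ for all $s,t\ge0$, $0\le\theta\le1$, in the sense of Calderón's complex interpolation; (iii) $\bigcap_{s\ge0}H^s$ is dense in $H^t$ for every $t\ge 0$. For self-adjoint operators $A,B$ in $H_1,H_2$ let $A\hat\otimes B$ be the closure of $A\otimes B$ on the algebraic tensor product of $\bigcap_n\mathcal D(A^n)$ and $\bigcap_n\mathcal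 D(B^n)$. If $X,Y$ are Hilbert spaces continuously embedded in $H_1,H_2$, then $X\hat\otimes Y$ is regarded as a subspace of $H_1\hat\otimes H_2$. **Proposition.** Let $\Lambda_1\ge I$ and $\Lambda_2\ge I$ be self-adjoint operators in Hilbert spaces $H_1$, $H_2$, generating the families $(H_1^s)_{s\ge0}$ and $(H_2^s)_{s\ge0}$, respectively. For $s\ge0$ let $$\mathcal H^s:=(H_1^s\hat\otimes H_2^0)\cap(H_1^0\hat\otimes H_2^s),$$ with the sum of the two scalar products. Then $(\mathcal H^s)_{s\ge 0}$ is an interpolation scale, and the operator $\Lambda_1\hat\otimes I+I\hat\otimes\Lambda_2$, with domain $\mathcal D(\Lambda_1\hat\otimes I)\cap\mathcal D(I\hat\otimes\Lambda_2)$, is self-adjoint and generates it. Moreover, for every $s\ge0$, as vector subspaces of $H_1\hat\otimes H_2$, $$\mathcal H^s=\bigcap_{0\le t\le s}H_1^t\hat\otimes H_2^{s-t}=(H_1^s\hat\otimes H_2^0)\cap(H_1^0\hat\otimes H_2^s).$$ -/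

import Mathlib

open scoped TensorProduct NNReal ComplexOrder ZeroAtInfty InnerProduct

universe u u₁ u₂ v v₁ v₂ w

noncomputable section

/-! ### Hilbert spaces continuously embedded into a fixed Hilbert space -/

/-- A complex Hilbert space `E` together with a continuous linear injection `ι : E → H` into the
Hilbert space `H`; via `ι` it is regarded as a linear subspace of `H` with its own norm. -/
structure HilbertSub (H : Type u) [NormedAddCommGroup H] [InnerProductSpace ℂ H] where
  E : Type v
  [normed : NormedAddCommGroup E]
  [inner : InnerProductSpace ℂ E]
  [complete : CompleteSpace E]
  ι : E →L[ℂ] H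
  inj : Function.Injective ι

attribute [instance] HilbertSub.normed HilbertSub.inner HilbertSub.complete

namespace HilbertSub

variable {H : Type u} [NormedAddCommGroup H] [InnerProductSpace ℂ H]

/-- The underlying linear subspace of `H`. -/
def carrier (X : HilbertSub.{u, v} H) : Submodule ℂ H := LinearMap.range X.ι.toLinearMap

/-- `X` is continuously embedded in `Y`. -/
def Embeds (X : HilbertSub.{u, v} H) (Y : HilbertSub.{u, w} H) : Prop :=
  ∃ j : X.E →L[ℂ] Y.E, ∀ x, Y.ι (j x) = X.ι x

/-- `X` and `Y` are the same subspace of `H`, with equivalent norms. -/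
def SameSpace (X : HilbertSub.{u, v} H) (Y : HilbertSub.{u, w} H) : Prop :=
  ∃ e : X.E ≃L[ℂ] Y.E, ∀ x, Y.ι (e x) = X.ι x

/-- The pairs `(x, y)` in `X × Y` that define the same element of `H`; the scalar product is
`⟪(x, y), (x', y')⟫ = ⟪x, x'⟫ + ⟪y, y'⟫`. -/
def interSubmodule (X : HilbertSub.{u, v} H) (Y : HilbertSub.{u, w} H) :
    Submodule ℂ (WithLp 2 (X.E × Y.E)) :=
  LinearMap.ker (X.ι ∘L WithLp.fstL 2 ℂ X.E Y.E - Y.ι ∘L WithLp.sndL 2 ℂ X.E Y.E).toLinearMap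

theorem isClosed_interSubmodule (X : HilbertSub.{u, v} H) (Y : HilbertSub.{u, w} H) :
    IsClosed (interSubmodule X Y : Set (WithLp 2 (X.E × Y.E))) :=
  ContinuousLinearMap.isClosed_ker
    (X.ι ∘L WithLp.fstL 2 ℂ X.E Y.E - Y.ι ∘L WithLp.sndL 2 ℂ X.E Y.E)

theorem mem_interSubmodule {X : HilbertSub.{u, v} H} {Y : HilbertSub.{u, w} H}
    {p : WithLp 2 (X.E × Y.E)} : p ∈ interSubmodule X Y ↔ X.ι p.fst = Y.ι p.snd := by
  simp [interSubmodule, LinearMap.mem_ker, sub_eq_zero]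

/-- The intersection of two embedded Hilbert spaces, with the sum of the two scalar products. -/
def inter (X : HilbertSub.{u, v} H) (Y : HilbertSub.{u, w} H) : HilbertSub.{u, max v w} H where
  E := interSubmodule X Y
  complete := (isClosed_interSubmodule X Y).completeSpace_coe
  ι := X.ι ∘L WithLp.fstL 2 ℂ X.E Y.E ∘L (interSubmodule X Y).subtypeL
  inj := by
    rintro ⟨p, hp⟩ ⟨q, hq⟩ h
    rw [mem_interSubmodule] at hp hq
    have h1 : X.ι p.fst = X.ι q.fst := h
    have h2 : Y.ι p.snd = Y.ι q.snd := by rw [← hp, ← hq, h1]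
    have e1 := X.inj h1
    have e2 := Y.inj h2
    apply Subtype.ext
    apply (WithLp.ofLp_injective 2)
    exact Prod.ext e1 e2

theorem carrier_inter (X : HilbertSub.{u, v} H) (Y : HilbertSub.{u, w} H) :
    (inter X Y).carrier = X.carrier ⊓ Y.carrier := by
  ext h
  constructor
  · rintro ⟨⟨p, hp⟩, rfl⟩
    exact ⟨⟨p.fst, rfl⟩, ⟨p.snd, (mem_interSubmodule.1 hp).symm⟩⟩
  · rintro ⟨⟨x, hx⟩, ⟨y, hy⟩⟩
    exact ⟨⟨WithLp.toLp 2 (x, y), mem_interSubmodule.2 (hx.trans hy.symm)⟩, hx⟩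

/-! ### Complex interpolation -/

/-- The kernel of `X × Y → H`, `(x, y) ↦ x + y`. -/
def sumKer (X : HilbertSub.{u, v} H) (Y : HilbertSub.{u, w} H) : Submodule ℂ (X.E × Y.E) :=
  LinearMap.ker (X.ι.coprod Y.ι).toLinearMap

instance isClosed_sumKer (X : HilbertSub.{u, v} H) (Y : HilbertSub.{u, w} H) :
    IsClosed (sumKer X Y : Set (X.E × Y.E)) :=
  ContinuousLinearMap.isClosed_ker (X.ι.coprod Y.ι)

/-- The (non-direct) sum `X + Y` as a Banach space: its norm is the quotient norm
`inf max(‖x‖, ‖y‖)` over all decompositions `x + y`, which is equivalent to `inf (‖x‖ + ‖y‖)`. -/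
abbrev SumSpace (X : HilbertSub.{u, v} H) (Y : HilbertSub.{u, w} H) : Type (max v w) :=
  (X.E × Y.E) ⧸ sumKer X Y

/-- The class of `x + y` in `X + Y`. -/
def SumSpace.mk (X : HilbertSub.{u, v} H) (Y : HilbertSub.{u, w} H) (x : X.E) (y : Y.E) :
    SumSpace X Y := (sumKer X Y).mkQ (x, y)

/-- The embedding `X + Y → H`. -/
def SumSpace.toAmbient (X : HilbertSub.{u, v} H) (Y : HilbertSub.{u, w} H) :
    SumSpace X Y →ₗ[ℂ] H :=
  (sumKer X Y).liftQ (X.ι.coprod Y.ι).toLinearMap le_rfl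

/-- Calderón's admissible functions for the pair `X, Y`: functions with values in `X + Y` which are
bounded and continuous on the strip `0 ≤ Re z ≤ 1` and holomorphic in its interior, such that
`y ↦ F(iy)` is a continuous function into `X` and `y ↦ F(1+iy)` is a continuous function into `Y`,
both vanishing at infinity. -/
structure CalderonFun (X : HilbertSub.{u, v} H) (Y : HilbertSub.{u, w} H) where
  F : ℂ → SumSpace X Y
  left : C₀(ℝ, X.E)
  right : C₀(ℝ, Y.E)
  diffContOnCl : DiffContOnCl ℂ F (Complex.HadamardThreeLines.verticalStrip 0 1)
  bounded : ∃ C : ℝ, ∀ z ∈ Complex.HadamardThreeLines.verticalClosedStrip 0 1, ‖F z‖ ≤ C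
  left_eq : ∀ y : ℝ, F ((y : ℂ) * Complex.I) = SumSpace.mk X Y (left y) 0
  right_eq : ∀ y : ℝ, F (1 + (y : ℂ) * Complex.I) = SumSpace.mk X Y 0 (right y)

/-- The complex interpolation space `[X, Y]_θ = {F(θ)}`, as a subset of `H`. -/
def interpolationSet (X : HilbertSub.{u, v} H) (Y : HilbertSub.{u, w} H) (θ : ℝ) : Set H :=
  {h | ∃ f : CalderonFun X Y, SumSpace.toAmbient X Y (f.F θ) = h}

/-- The norm of `[X, Y]_θ`: the infimum of
`max (sup_y ‖F(iy)‖_X) (sup_y ‖F(1+iy)‖_Y)` over all admissible `F` with `F(θ) = h`. -/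
def interpolationNorm (X : HilbertSub.{u, v} H) (Y : HilbertSub.{u, w} H) (θ : ℝ) (h : H) : ℝ :=
  sInf {r | ∃ f : CalderonFun X Y,
    SumSpace.toAmbient X Y (f.F θ) = h ∧ r = max ‖f.left‖ ‖f.right‖}

/-- `[X, Y]_θ = Z` as spaces, with equivalent norms. -/
def InterpolatesTo (X : HilbertSub.{u, v} H) (Y : HilbertSub.{u, w} H) (θ : ℝ)
    (Z : HilbertSub.{u, w} H) : Prop :=
  interpolationSet X Y θ = (Z.carrier : Set H) ∧
    ∃ c C : ℝ, 0 < c ∧ 0 < C ∧ ∀ z : Z.E,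
      c * ‖z‖ ≤ interpolationNorm X Y θ (Z.ι z) ∧ interpolationNorm X Y θ (Z.ι z) ≤ C * ‖z‖

end HilbertSub

/-! ### Scales of Hilbert spaces -/

section Scales

variable {H : Type u} [NormedAddCommGroup H] [InnerProductSpace ℂ H]

/-- An interpolation scale of Hilbert spaces `(X s)_{s ≥ 0}` inside `H`. -/
structure IsInterpolationScale (X : ℝ≥0 → HilbertSub.{u, v} H) : Prop where
  embeds : ∀ s s' : ℝ≥0, s ≤ s' → (X s').Embeds (X s)
  interpolates : ∀ s t θ : ℝ≥0, θ ≤ 1 →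
    (X s).InterpolatesTo (X t) θ (X (θ * t + (1 - θ) * s))
  dense : ∀ t : ℝ≥0, Dense {x : (X t).E | ∀ s : ℝ≥0, (X t).ι x ∈ (X s).carrier}

/-- The graph of an unbounded operator, as a subspace of the Hilbert space `H ⊕ H`. -/
def hilbertGraph (A : H →ₗ.[ℂ] H) : Submodule ℂ (WithLp 2 (H × H)) :=
  A.graph.comap (WithLp.linearEquiv 2 ℂ (H × H)).toLinearMap

/-- The map `(x, A x) ↦ x`, that is, the inclusion of the domain of `A` with its graph norm. -/
def graphFst (A : H →ₗ.[ℂ] H) : hilbertGraph A →L[ℂ] H :=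
  WithLp.fstL 2 ℂ H H ∘L (hilbertGraph A).subtypeL

theorem mem_hilbertGraph {A : H →ₗ.[ℂ] H} {p : WithLp 2 (H × H)} :
    p ∈ hilbertGraph A ↔ (p.fst, p.snd) ∈ A.graph := Iff.rfl

theorem graphFst_injective (A : H →ₗ.[ℂ] H) : Function.Injective (graphFst A) := by
  rw [injective_iff_map_eq_zero]
  rintro ⟨p, hp⟩ h
  have h1 : p.fst = 0 := h
  have h2 : p.snd = 0 := A.graph_fst_eq_zero_snd (mem_hilbertGraph.1 hp) h1
  apply Subtype.ext
  apply WithLp.ofLp_injective 2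
  exact Prod.ext h1 h2

variable [CompleteSpace H]

theorem completeSpace_hilbertGraph {A : H →ₗ.[ℂ] H} (hA : IsSelfAdjoint A) :
    CompleteSpace (hilbertGraph A) := by
  have : IsClosed (hilbertGraph A : Set (WithLp 2 (H × H))) :=
    (hA.isClosed : IsClosed (A.graph : Set (H × H))).preimage (WithLp.prod_continuous_ofLp 2 H H)
  exact this.completeSpace_coe

/-- The bounded operator `(I + A²)⁻¹`, written as `i i*` with `i` the inclusion of the domain of
`A` (with its graph norm) into `H`; the next theorem says that it is `(I + A²)⁻¹`. -/
def invOneAddSq (A : H →ₗ.[ℂ] H) (hA : IsSelfAdjoint A) : H →L[ℂ] H :=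
  haveI := completeSpace_hilbertGraph hA
  graphFst A ∘L ContinuousLinearMap.adjoint (graphFst A)

theorem invOneAddSq_spec (A : H →ₗ.[ℂ] H) (hA : IsSelfAdjoint A) (x : H) :
    ∃ y z : H, (invOneAddSq A hA x, y) ∈ A.graph ∧ (y, z) ∈ A.graph ∧
      invOneAddSq A hA x + z = x := by
  have := completeSpace_hilbertGraph hA
  set p := ContinuousLinearMap.adjoint (graphFst A) x with hp
  have hx : invOneAddSq A hA x = p.1.fst := rfl
  refine ⟨p.1.snd, x - p.1.fst, hx ▸ mem_hilbertGraph.1 p.2, ?_, by rw [hx]; abel⟩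
  have hg : A.graph = A.graph.adjoint := by
    conv_lhs => rw [← LinearPMap.isSelfAdjoint_def.1 hA]
    exact LinearPMap.adjoint_graph_eq_graph_adjoint hA.dense_domain
  rw [hg, Submodule.mem_adjoint_iff]
  intro a b hab
  have := ContinuousLinearMap.adjoint_inner_right (graphFst A)
    ⟨WithLp.toLp 2 (a, b), mem_hilbertGraph.2 hab⟩ x
  rw [← hp] at this
  have h2 : inner ℂ a p.1.fst + inner ℂ b p.1.snd = inner ℂ a x := this
  rw [inner_sub_right, ← h2]
  ring

theorem invOneAddSq_nonneg (A : H →ₗ.[ℂ] H) (hA : IsSelfAdjoint A) : 0 ≤ invOneAddSq A hA := by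
  have := completeSpace_hilbertGraph hA
  rw [ContinuousLinearMap.nonneg_iff_isPositive]
  have := (ContinuousLinearMap.isPositive_one (𝕜 := ℂ) (E := hilbertGraph A)).conj_adjoint
    (graphFst A)
  exact this

theorem invOneAddSq_injective (A : H →ₗ.[ℂ] H) (hA : IsSelfAdjoint A) :
    Function.Injective (invOneAddSq A hA) := by
  rw [injective_iff_map_eq_zero]
  intro x hx
  obtain ⟨y, z, h1, h2, h3⟩ := invOneAddSq_spec A hA x
  rw [hx] at h1 h3
  have hy : y = 0 := A.graph_fst_eq_zero_snd h1 rfl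
  have hz : z = 0 := A.graph_fst_eq_zero_snd h2 hy
  simpa [hz] using h3.symm

theorem rpow_injective_of_nonneg {R : H →L[ℂ] H} (hR : 0 ≤ R) (hinj : Function.Injective R)
    {a : ℝ} (ha : 0 ≤ a) : Function.Injective (R ^ a : H →L[ℂ] H) := by
  obtain ⟨n, hn⟩ := exists_nat_ge a
  have key : (R ^ ((n : ℝ) - a) : H →L[ℂ] H) * R ^ a = R ^ n := by
    rw [CFC.rpow_def, CFC.rpow_def, ← cfc_mul _ _ R
      (NNReal.continuous_rpow_const (by linarith)).continuousOn
      (NNReal.continuous_rpow_const ha).continuousOn]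
    rw [← CFC.rpow_natCast R n hR, CFC.rpow_def]
    apply cfc_congr
    intro t _
    show t ^ ((n : ℝ) - a) * t ^ a = t ^ (n : ℝ)
    rw [← NNReal.rpow_add_of_nonneg _ (by linarith) ha]
    congr 1
    ring
  have hpow : Function.Injective (R ^ n : H →L[ℂ] H) := by
    clear key hn
    induction n with
    | zero => exact fun x y h => h
    | succ n ih =>
      rw [pow_succ]
      exact ih.comp hinj
  intro x y hxy
  apply hpow
  rw [← key]
  simp [hxy]

/-- The space `H^s(A)` for a self-adjoint operator `A`: the range of `(I + A²)^(-s/2)`, i.e. the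
domain of `(I + A²)^(s/2)`, with the scalar product
`⟪x, y⟫_s = ⟪(I + A²)^(s/2) x, (I + A²)^(s/2) y⟫`, so that `(I + A²)^(-s/2)` is a unitary map
from `H` onto `H^s(A)`. -/
def sobolevSpace (A : H →ₗ.[ℂ] H) (hA : IsSelfAdjoint A) (s : ℝ≥0) : HilbertSub.{u, u} H where
  E := H
  ι := (invOneAddSq A hA ^ ((s : ℝ) / 2) : H →L[ℂ] H)
  inj := rpow_injective_of_nonneg (invOneAddSq_nonneg A hA) (invOneAddSq_injective A hA)
    (by positivity)

/-- The self-adjoint operator `A` generates the family `(X s)_{s ≥ 0}`: `X s = H^s(A)` for all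
`s ≥ 0`, with equivalent norms. -/
def IsGenerator (A : H →ₗ.[ℂ] H) (X : ℝ≥0 → HilbertSub.{u, v} H) : Prop :=
  ∃ hA : IsSelfAdjoint A, ∀ s : ℝ≥0, (X s).SameSpace (sobolevSpace A hA s)

end Scales

/-- `A ≥ I` in the sense of quadratic forms. -/
def OneLe {H : Type u} [NormedAddCommGroup H] [InnerProductSpace ℂ H] (A : H →ₗ.[ℂ] H) : Prop :=
  ∀ x : A.domain, ‖(x : H)‖ ^ 2 ≤ (inner ℂ (A x) (x : H)).re

/-! ### Completed tensor products -/

section Tensor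

/-- The Hilbert space tensor product. -/
abbrev HTensor (H₁ : Type u₁) (H₂ : Type u₂) [NormedAddCommGroup H₁] [InnerProductSpace ℂ H₁]
    [NormedAddCommGroup H₂] [InnerProductSpace ℂ H₂] : Type (max u₁ u₂) :=
  UniformSpace.Completion (H₁ ⊗[ℂ] H₂)

variable {H₁ : Type u₁} {H₂ : Type u₂} [NormedAddCommGroup H₁] [InnerProductSpace ℂ H₁]
  [NormedAddCommGroup H₂] [InnerProductSpace ℂ H₂]

/-- The continuous extension of `S ⊗ T` to the completed tensor products. -/
def hTensorMap {E₁ : Type v₁} {E₂ : Type v₂} [NormedAddCommGroup E₁] [InnerProductSpace ℂ E₁]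
    [NormedAddCommGroup E₂] [InnerProductSpace ℂ E₂] (S : E₁ →L[ℂ] H₁) (T : E₂ →L[ℂ] H₂) :
    HTensor E₁ E₂ →L[ℂ] HTensor H₁ H₂ :=
  (TensorProduct.mapL S T).completion

theorem denseRange_adjoint {E : Type v} {K : Type u} [NormedAddCommGroup E]
    [InnerProductSpace ℂ E] [NormedAddCommGroup K] [InnerProductSpace ℂ K] [CompleteSpace E]
    [CompleteSpace K] (S : E →L[ℂ] K) (hS : Function.Injective S) :
    DenseRange (ContinuousLinearMap.adjoint S) := by
  have h : (ContinuousLinearMap.adjoint S).rangeᗮ = ⊥ := by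
    rw [ContinuousLinearMap.orthogonal_range, ContinuousLinearMap.adjoint_adjoint]
    exact LinearMap.ker_eq_bot.2 hS
  have h2 := (Submodule.topologicalClosure_eq_top_iff).2 h
  exact Submodule.dense_iff_topologicalClosure_eq_top.2 h2

theorem hTensorMap_injective {E₁ : Type v₁} {E₂ : Type v₂} [NormedAddCommGroup E₁]
    [InnerProductSpace ℂ E₁] [NormedAddCommGroup E₂] [InnerProductSpace ℂ E₂]
    [CompleteSpace E₁] [CompleteSpace E₂] [CompleteSpace H₁] [CompleteSpace H₂]
    (S : E₁ →L[ℂ] H₁) (T : E₂ →L[ℂ] H₂)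
    (hS : Function.Injective S) (hT : Function.Injective T) :
    Function.Injective (hTensorMap S T) := by
  have key : ∀ (a : H₁) (b : H₂) (x : HTensor E₁ E₂),
      inner ℂ ((a ⊗ₜ[ℂ] b : H₁ ⊗[ℂ] H₂) : HTensor H₁ H₂) (hTensorMap S T x) =
      inner ℂ ((ContinuousLinearMap.adjoint S a ⊗ₜ[ℂ] ContinuousLinearMap.adjoint T b :
        E₁ ⊗[ℂ] E₂) : HTensor E₁ E₂) x := by
    intro a b x
    induction x using UniformSpace.Completion.induction_on with
    | hp => exact isClosed_eq (by fun_prop) (by fun_prop)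
    | ih x =>
      rw [hTensorMap, ContinuousLinearMap.completion_apply_coe, UniformSpace.Completion.inner_coe,
        UniformSpace.Completion.inner_coe]
      induction x using TensorProduct.induction_on with
      | zero => simp
      | tmul x y =>
        simp [TensorProduct.inner_tmul, ContinuousLinearMap.adjoint_inner_left]
      | add x y hx hy => simp only [map_add, inner_add_right, hx, hy]
  rw [injective_iff_map_eq_zero]
  intro x hx
  have h0 : ∀ p : E₁ × E₂, inner ℂ ((p.1 ⊗ₜ[ℂ] p.2 : E₁ ⊗[ℂ] E₂) : HTensor E₁ E₂) x = 0 := by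
    have hc : Continuous fun p : E₁ × E₂ => ((p.1 ⊗ₜ[ℂ] p.2 : E₁ ⊗[ℂ] E₂) : HTensor E₁ E₂) :=
      (UniformSpace.Completion.continuous_coe _).comp TensorProduct.continuous_tmul
    have hd := (denseRange_adjoint S hS).prodMap (denseRange_adjoint T hT)
    intro p
    refine hd.induction_on (p := fun p : E₁ × E₂ =>
      inner ℂ ((p.1 ⊗ₜ[ℂ] p.2 : E₁ ⊗[ℂ] E₂) : HTensor E₁ E₂) x = 0) p
      (isClosed_eq (hc.inner continuous_const) continuous_const) fun q => ?_
    have := key q.1 q.2 x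
    rw [hx, inner_zero_right] at this
    exact this.symm
  refine UniformSpace.Completion.denseRange_coe.eq_zero_of_inner_right ℂ fun z => ?_
  induction z using TensorProduct.induction_on with
  | zero => rw [UniformSpace.Completion.coe_zero, inner_zero_left]
  | tmul a b => exact h0 (a, b)
  | add a b ha hb => rw [UniformSpace.Completion.coe_add, inner_add_left, ha, hb, add_zero]

/-- `X ⊗̂ Y` as a subspace of `H₁ ⊗̂ H₂`. -/
def HilbertSub.tensor [CompleteSpace H₁] [CompleteSpace H₂]
    (X : HilbertSub.{u₁, v₁} H₁) (Y : HilbertSub.{u₂, v₂} H₂) :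
    HilbertSub.{max u₁ u₂, max v₁ v₂} (HTensor H₁ H₂) where
  E := HTensor X.E Y.E
  ι := hTensorMap X.ι Y.ι
  inj := hTensorMap_injective X.ι Y.ι X.inj Y.inj

/-- The domain of the power `Aⁿ` of an unbounded operator. -/
def powDomain {H : Type u} [NormedAddCommGroup H] [InnerProductSpace ℂ H] (A : H →ₗ.[ℂ] H) :
    ℕ → Submodule ℂ H
  | 0 => ⊤
  | n + 1 => ((powDomain A n).comap A.toFun).map A.domain.subtype

/-- `⋂ₙ 𝓓(Aⁿ)`. -/
def smoothDomain {H : Type u} [NormedAddCommGroup H] [InnerProductSpace ℂ H] (A : H →ₗ.[ℂ] H) :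
    Submodule ℂ H := ⨅ n, powDomain A n

theorem smoothDomain_le {H : Type u} [NormedAddCommGroup H] [InnerProductSpace ℂ H]
    (A : H →ₗ.[ℂ] H) : smoothDomain A ≤ A.domain :=
  (iInf_le _ 1).trans (Submodule.map_subtype_le _ _)

/-- The inclusion of the algebraic tensor product of two subspaces into `H₁ ⊗̂ H₂`. -/
def algIncl (D₁ : Submodule ℂ H₁) (D₂ : Submodule ℂ H₂) : D₁ ⊗[ℂ] D₂ →ₗ[ℂ] HTensor H₁ H₂ :=
  (UniformSpace.Completion.toComplL (𝕜 := ℂ) (E := H₁ ⊗[ℂ] H₂)).toLinearMap ∘ₗ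
    TensorProduct.map D₁.subtype D₂.subtype

theorem algIncl_injective (D₁ : Submodule ℂ H₁) (D₂ : Submodule ℂ H₂) :
    Function.Injective (algIncl D₁ D₂) :=
  (UniformSpace.Completion.coe_injective (H₁ ⊗[ℂ] H₂)).comp
    (TensorProduct.map_injective_of_flat_flat _ _ D₁.subtype_injective D₂.subtype_injective)

/-- `A ⊗ B` on the algebraic tensor product of `⋂ₙ 𝓓(Aⁿ)` and `⋂ₙ 𝓓(Bⁿ)`. -/
def algTensorOp (A : H₁ →ₗ.[ℂ] H₁) (B : H₂ →ₗ.[ℂ] H₂) :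
    HTensor H₁ H₂ →ₗ.[ℂ] HTensor H₁ H₂ where
  domain := LinearMap.range (algIncl (smoothDomain A) (smoothDomain B))
  toFun :=
    (UniformSpace.Completion.toComplL (𝕜 := ℂ) (E := H₁ ⊗[ℂ] H₂)).toLinearMap ∘ₗ
      TensorProduct.map (A.toFun ∘ₗ Submodule.inclusion (smoothDomain_le A))
        (B.toFun ∘ₗ Submodule.inclusion (smoothDomain_le B)) ∘ₗ
      (LinearEquiv.ofInjective _
        (algIncl_injective (smoothDomain A) (smoothDomain B))).symm.toLinearMap

/-- The tensor product `A ⊗̂ B` of unbounded operators: the closure of the algebraic one. -/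
def tensorOp (A : H₁ →ₗ.[ℂ] H₁) (B : H₂ →ₗ.[ℂ] H₂) :
    HTensor H₁ H₂ →ₗ.[ℂ] HTensor H₁ H₂ := (algTensorOp A B).closure

/-- The identity, as an everywhere defined operator. -/
def idOp (H : Type u) [NormedAddCommGroup H] [InnerProductSpace ℂ H] : H →ₗ.[ℂ] H :=
  (LinearMap.id : H →ₗ[ℂ] H).toPMap ⊤

/-- `A ⊗̂ I + I ⊗̂ B`, with domain the intersection of the domains of the two summands. -/
def tensorSum (A : H₁ →ₗ.[ℂ] H₁) (B : H₂ →ₗ.[ℂ] H₂) :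
    HTensor H₁ H₂ →ₗ.[ℂ] HTensor H₁ H₂ :=
  tensorOp A (idOp H₂) + tensorOp (idOp H₁) B

/-- The spaces `𝓗^s = X₁^s ⊗̂ X₂^0 ∩ X₁^0 ⊗̂ X₂^s`, with the sum of the two scalar products. -/
def productScale [CompleteSpace H₁] [CompleteSpace H₂]
    (X₁ : ℝ≥0 → HilbertSub.{u₁, v₁} H₁) (X₂ : ℝ≥0 → HilbertSub.{u₂, v₂} H₂) (s : ℝ≥0) :
    HilbertSub.{max u₁ u₂, max v₁ v₂} (HTensor H₁ H₂) :=
  ((X₁ s).tensor (X₂ 0)).inter ((X₁ 0).tensor (X₂ s))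

end Tensor

end

/-! The unbounded operators are traded for bounded ones. Since `Λ₁, Λ₂ ≥ I`, their inverses `P`, `Q`
are injective positive contractions. As the spectrum of `P` lies in `[0, 1]`, the operator `(I +
Λ₁²)⁻¹ = P² / (1 + P²)` is comparable to `P²`, so `H₁^s` is the range of `P^s`
(`carrier_sobolevSpace`). By the closed graph theorem, Hilbert spaces embedded in `H` with the same
underlying subspace have equivalent norms (`embeds_of_carrier_le`), so embedding and generation
become questions about ranges. Range inclusions follow from pointwise inequalities between symbols
on the spectrum, by Douglas' lemma (`range_cfc_le`).

On the tensor product, `p = P ⊗ 1` and `q = 1 ⊗ Q` commute, and `H₁^s ⊗̂ H₂^t` is the range of `p^s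
q^t`. The functional calculus of the normal operator `p + i q` treats them as two coordinates `x, y
∈ [0, 1]`. The inverse of the operator sum has symbol `m = xy / (x + y)`, and `min x y / 2 ≤ m ≤ min
x y`. The upper bound gives `m^(s+t) ≤ x^s y^t`, hence the range of `m^(s+t)` lies in that of `p^s
q^t`. The lower bound shows that the ranges of `p^s` and `q^s` meet exactly in the range of `m^s`
(`range_rpow_inf_range_rpow`). The case `s = 1` identifies the domain of the sum
(`isBoundedInverse_add`), and general `s` identifies `𝓗^s`.

Finally, the ranges of the powers of one injective positive contraction `w` form an interpolation
scale (`isInterpolationScale_of_carrier_eq`). One inclusion comes from the admissible functions `z ↦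
w^((1-z)s + zt) k`, damped by a Gaussian. The other is the three lines theorem for `w^(-(1-z)s - zt)
F(z)`, with `w` truncated away from `0` and bounds independent of the truncation. -/

noncomputable section

/-! ### Ranges of bounded operators and comparison of symbols -/

section Operators

variable {K : Type*} [NormedAddCommGroup K] [InnerProductSpace ℂ K] [CompleteSpace K]

/-- The hypothesis makes `B* v ↦ ⟪h, v⟫` a well-defined functional of norm at most `M` on the range
of `B*`. Extend it by Hahn–Banach and represent it by Riesz: the representing vector is `k`. -/
theorem exists_apply_eq_of_inner_le {E : Type*} [NormedAddCommGroup E] [InnerProductSpace ℂ E]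
    [CompleteSpace E] (B : E →L[ℂ] K) (h : K) {M : ℝ} (hM : 0 ≤ M)
    (hB : ∀ v : K, ‖inner ℂ h v‖ ≤ M * ‖ContinuousLinearMap.adjoint B v‖) :
    ∃ k : E, ‖k‖ ≤ M ∧ B k = h := by
  set T : K →ₗ[ℂ] E := (ContinuousLinearMap.adjoint B).toLinearMap with hT
  have hker : T.ker ≤ (innerSL ℂ h).toLinearMap.ker := by
    intro v hv
    have h1 : ContinuousLinearMap.adjoint B v = 0 := hv
    have := hB v
    rw [h1, norm_zero, mul_zero] at this
    exact norm_le_zero_iff.1 this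
  set f : T.range →ₗ[ℂ] ℂ :=
    (T.ker.liftQ (innerSL ℂ h).toLinearMap hker) ∘ₗ T.quotKerEquivRange.symm.toLinearMap with hf
  have hfT : ∀ v, f ⟨T v, ⟨v, rfl⟩⟩ = inner ℂ h v := by
    intro v
    have : T.quotKerEquivRange.symm ⟨T v, ⟨v, rfl⟩⟩ = T.ker.mkQ v := by
      rw [LinearEquiv.symm_apply_eq]; rfl
    simp [hf, this]
  have hbound : ∀ y : T.range, ‖f y‖ ≤ M * ‖y‖ := by
    rintro ⟨_, ⟨v, rfl⟩⟩
    rw [hfT]; exact hB v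
  obtain ⟨g, hg, hgn⟩ := exists_extension_norm_eq T.range (f.mkContinuous M hbound)
  refine ⟨(InnerProductSpace.toDual ℂ E).symm g, ?_, ?_⟩
  · rw [LinearIsometryEquiv.norm_map, hgn]
    exact LinearMap.mkContinuous_norm_le _ hM _
  · refine ext_inner_right ℂ fun v => ?_
    rw [← ContinuousLinearMap.adjoint_inner_right, InnerProductSpace.toDual_symm_apply]
    rw [← hfT v]
    exact hg ⟨T v, ⟨v, rfl⟩⟩

/-- Douglas' lemma, which turns norm estimates into range inclusions. -/
theorem range_le_range_of_norm_adjoint_le {A B : K →L[ℂ] K} {C : ℝ} (hC : 0 ≤ C)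
    (h : ∀ v, ‖ContinuousLinearMap.adjoint A v‖ ≤ C * ‖ContinuousLinearMap.adjoint B v‖) :
    A.range ≤ B.range := by
  rintro _ ⟨x, rfl⟩
  obtain ⟨k, -, hk⟩ := exists_apply_eq_of_inner_le B (A x) (M := ‖x‖ * C) (by positivity)
    fun v => by
      rw [← ContinuousLinearMap.adjoint_inner_right]
      refine (norm_inner_le_norm _ _).trans ?_
      rw [mul_assoc]
      exact mul_le_mul_of_nonneg_left (h v) (norm_nonneg _)
  exact ⟨k, hk⟩

/-- Here `‖f(n) v‖² = ⟪(f̄ f)(n) v, v⟫`, and `C²|g|² - |f|² ≥ 0` on the spectrum gives a positive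
operator. With `g = 1` this becomes an operator norm bound. -/
theorem norm_cfc_apply_le {n : K →L[ℂ] K} [IsStarNormal n] {f g : ℂ → ℂ}
    (hf : ContinuousOn f (spectrum ℂ n)) (hg : ContinuousOn g (spectrum ℂ n)) {C : ℝ} (hC : 0 ≤ C)
    (h : ∀ z ∈ spectrum ℂ n, ‖f z‖ ≤ C * ‖g z‖) (v : K) :
    ‖cfc f n v‖ ≤ C * ‖cfc g n v‖ := by
  have key : ∀ {f : ℂ → ℂ}, ContinuousOn f (spectrum ℂ n) →
      ((‖cfc f n v‖ ^ 2 : ℝ) : ℂ) = inner ℂ (cfc (fun z => star (f z) * f z) n v) v := by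
    intro f hf
    rw [cfc_mul _ _ n (by fun_prop) hf, cfc_star, mul_apply_eq_comp,
      ContinuousLinearMap.star_eq_adjoint, ContinuousLinearMap.adjoint_inner_left,
      inner_self_eq_norm_sq_to_K]
    norm_cast
  have hpos : 0 ≤ cfc (fun z => (C : ℂ) ^ 2 * (star (g z) * g z) - star (f z) * f z) n := by
    refine cfc_nonneg fun z hz => ?_
    have h2 := pow_le_pow_left₀ (norm_nonneg _) (h z hz) 2
    have e : ∀ w : ℂ, star w * w = ((‖w‖ ^ 2 : ℝ) : ℂ) := fun w => by
      rw [Complex.star_def, mul_comm, Complex.mul_conj, Complex.normSq_eq_norm_sq]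
    rw [e, e, sub_nonneg]
    rw [mul_pow] at h2
    exact_mod_cast h2
  rw [cfc_sub _ _ n (by fun_prop) (by fun_prop), cfc_const_mul _ _ n (by fun_prop),
    ContinuousLinearMap.nonneg_iff_isPositive] at hpos
  have h3 := hpos.inner_nonneg_left v
  rw [sub_apply, inner_sub_left, smul_apply, inner_smul_left, ← key hf, ← key hg] at h3
  simp only [map_pow, Complex.conj_ofReal] at h3
  have h4 : ‖cfc f n v‖ ^ 2 ≤ C ^ 2 * ‖cfc g n v‖ ^ 2 := by
    rw [sub_nonneg] at h3
    exact_mod_cast h3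
  rw [← mul_pow] at h4
  exact le_of_sq_le_sq h4 (by positivity)

theorem range_cfc_le {n : K →L[ℂ] K} [IsStarNormal n] {f g : ℂ → ℂ}
    (hf : ContinuousOn f (spectrum ℂ n)) (hg : ContinuousOn g (spectrum ℂ n)) {C : ℝ} (hC : 0 ≤ C)
    (h : ∀ z ∈ spectrum ℂ n, ‖f z‖ ≤ C * ‖g z‖) :
    (cfc f n).range ≤ (cfc g n).range := by
  refine range_le_range_of_norm_adjoint_le hC fun v => ?_
  rw [← ContinuousLinearMap.star_eq_adjoint, ← ContinuousLinearMap.star_eq_adjoint, ← cfc_star,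
    ← cfc_star]
  exact norm_cfc_apply_le (by fun_prop) (by fun_prop) hC (by simpa using h) v

theorem spectrum_mem_Icc {w : K →L[ℂ] K} (hw : 0 ≤ w) (hw1 : ‖w‖ ≤ 1) {x : ℝ}
    (hx : x ∈ spectrum ℝ w) : x ∈ Set.Icc (0 : ℝ) 1 := by
  refine ⟨spectrum_nonneg_of_nonneg hw hx, ?_⟩
  -- The bound of the spectrum by `‖w‖` uses `‖1‖ = 1`; over the zero space the spectrum is empty.
  have : Nontrivial (K →L[ℂ] K) := by
    by_contra hn
    rw [not_nontrivial_iff_subsingleton] at hn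
    rw [spectrum.of_subsingleton] at hx
    exact hx
  have := spectrum.norm_le_norm_of_mem hx
  exact (Real.le_norm_self x).trans (this.trans hw1)

theorem continuousOn_ofReal_comp_re {w : K →L[ℂ] K} (hw : IsSelfAdjoint w) {f : ℝ → ℝ}
    (hf : ContinuousOn f (spectrum ℝ w)) :
    ContinuousOn (fun z : ℂ => ((f z.re : ℝ) : ℂ)) (spectrum ℂ w) := by
  refine Complex.continuous_ofReal.comp_continuousOn (hf.comp (by fun_prop) fun z hz => ?_)
  rw [← hw.spectrumRestricts.image]
  exact ⟨z, hz, rfl⟩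

theorem re_mem_spectrum {w : K →L[ℂ] K} (hw : IsSelfAdjoint w) {z : ℂ} (hz : z ∈ spectrum ℂ w) :
    z.re ∈ spectrum ℝ w := by
  rw [← hw.spectrumRestricts.image]
  exact ⟨z, hz, rfl⟩

theorem norm_cfc_real_apply_le {w : K →L[ℂ] K} (hw : IsSelfAdjoint w) {f g : ℝ → ℝ}
    (hf : ContinuousOn f (spectrum ℝ w)) (hg : ContinuousOn g (spectrum ℝ w)) {C : ℝ} (hC : 0 ≤ C)
    (h : ∀ x ∈ spectrum ℝ w, |f x| ≤ C * |g x|) (v : K) :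
    ‖cfc f w v‖ ≤ C * ‖cfc g w v‖ := by
  have := hw.isStarNormal
  rw [cfc_real_eq_complex f, cfc_real_eq_complex g]
  exact norm_cfc_apply_le (continuousOn_ofReal_comp_re hw hf) (continuousOn_ofReal_comp_re hw hg) hC
    (fun z hz => by simpa using h z.re (re_mem_spectrum hw hz)) v

theorem range_cfc_real_le {w : K →L[ℂ] K} (hw : IsSelfAdjoint w) {f g : ℝ → ℝ}
    (hf : ContinuousOn f (spectrum ℝ w)) (hg : ContinuousOn g (spectrum ℝ w)) {C : ℝ} (hC : 0 ≤ C)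
    (h : ∀ x ∈ spectrum ℝ w, |f x| ≤ C * |g x|) :
    (cfc f w).range ≤ (cfc g w).range := by
  have := hw.isStarNormal
  rw [cfc_real_eq_complex f, cfc_real_eq_complex g]
  exact range_cfc_le (continuousOn_ofReal_comp_re hw hf) (continuousOn_ofReal_comp_re hw hg) hC
    (fun z hz => by simpa using h z.re (re_mem_spectrum hw hz))

theorem rpow_add_eq_mul {w : K →L[ℂ] K} {a b : ℝ} (ha : 0 ≤ a) (hb : 0 ≤ b) :
    w ^ (a + b) = w ^ a * w ^ b := by
  simp only [CFC.rpow_def]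
  rw [← cfc_mul _ _ w (NNReal.continuous_rpow_const ha).continuousOn
      (NNReal.continuous_rpow_const hb).continuousOn]
  exact cfc_congr fun x _ => NNReal.rpow_add_of_nonneg x ha hb

theorem range_rpow_anti {w : K →L[ℂ] K} {a b : ℝ} (ha : 0 ≤ a) (hab : a ≤ b) :
    (w ^ b : K →L[ℂ] K).range ≤ (w ^ a : K →L[ℂ] K).range := by
  have := rpow_add_eq_mul (w := w) ha (sub_nonneg.2 hab)
  rw [add_sub_cancel] at this
  rw [this]
  rintro _ ⟨x, rfl⟩
  exact ⟨_, rfl⟩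

theorem denseRange_of_isSelfAdjoint {w : K →L[ℂ] K} (hw : IsSelfAdjoint w)
    (hi : Function.Injective w) : DenseRange w := by
  have := denseRange_adjoint w hi
  rwa [← ContinuousLinearMap.star_eq_adjoint, hw.star_eq] at this

/-- The range of `w` is dense, and `w v` is the limit of `f n (w) v` because `f n` is within `1 / (n
+ 1)` of the identity on the spectrum. As `f n` vanishes on `[0, 1 / (n + 1)]`, it is dominated by a
multiple of every power `x^s`. -/
theorem dense_iInf_range_rpow {w : K →L[ℂ] K} (hw : 0 ≤ w) (hi : Function.Injective w) :
    Dense {x : K | ∀ s : ℝ≥0, x ∈ (w ^ (s : ℝ) : K →L[ℂ] K).range} := by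
  have hsa : IsSelfAdjoint w := .of_nonneg hw
  refine dense_iff_closure_eq.2 (Set.eq_univ_of_univ_subset ?_)
  rw [← (denseRange_of_isSelfAdjoint hsa hi).closure_range]
  refine closure_minimal ?_ isClosed_closure
  rintro _ ⟨v, rfl⟩
  set f : ℕ → ℝ → ℝ := fun n x => max (x - 1 / (n + 1)) 0 with hf
  have hlim : Filter.Tendsto (fun n : ℕ => cfc (f n) w v) Filter.atTop (nhds (w v)) := by
    rw [tendsto_iff_norm_sub_tendsto_zero]
    refine squeeze_zero (fun _ => norm_nonneg _) (g := fun n : ℕ => 1 / ((n : ℝ) + 1) * ‖v‖) ?_ ?_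
    · intro n
      have h1 : cfc (f n) w - w = cfc (fun x => f n x - x) w := by
        rw [cfc_sub _ _ w (by fun_prop) (by fun_prop), cfc_id' ℝ w]
      have h2 := norm_cfc_real_apply_le hsa (f := fun x => f n x - x) (g := fun _ => 1)
        (C := 1 / (n + 1)) (by fun_prop) (by fun_prop) (by positivity) (fun x hx => by
          have hx0 := spectrum_nonneg_of_nonneg hw hx
          have hn : (0 : ℝ) < 1 / (n + 1) := by positivity
          simp only [hf, abs_one, mul_one]
          rw [abs_le]
          constructor
          · linarith [le_max_left (x - 1 / ((n : ℝ) + 1)) 0]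
          · rw [sub_le_iff_le_add]
            exact max_le (by linarith) (by linarith)) v
      rw [cfc_const_one ℝ w] at h2
      rw [← sub_apply, h1]
      simpa using h2
    · simpa using (tendsto_one_div_add_atTop_nhds_zero_nat (𝕜 := ℝ)).mul_const ‖v‖
  refine mem_closure_of_tendsto hlim (Filter.Eventually.of_forall fun n s => ?_)
  rw [CFC.rpow_eq_cfc_real hw]
  have hn : (0 : ℝ) < 1 / (n + 1) := by positivity
  have hb : ∃ C : ℝ, ∀ x ∈ spectrum ℝ w, |f n x| ≤ C := by
    have := (spectrum.isCompact (𝕜 := ℝ) w).exists_bound_of_continuousOn (f := f n) (by fun_prop)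
    simpa using this
  obtain ⟨C, hCb⟩ := hb
  -- Where `f n` is nonzero, `x > 1 / (n + 1)`, so `x^s` is at least `(1 / (n + 1))^s`; `C` bounds
  -- `f n` on the compact spectrum.
  refine range_cfc_real_le hsa (by fun_prop) (Real.continuous_rpow_const s.2).continuousOn
    (C := max C 0 * ((1 / ((n : ℝ) + 1)) ^ (s : ℝ))⁻¹) (by positivity) (fun x hx => ?_) ⟨v, rfl⟩
  have hx0 := spectrum_nonneg_of_nonneg hw hx
  rw [abs_of_nonneg (Real.rpow_nonneg hx0 _)]
  rcases le_or_gt x (1 / ((n : ℝ) + 1)) with hle | hlt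
  · have : f n x = 0 := max_eq_right (by linarith)
    rw [this, abs_zero]
    positivity
  · refine (hCb x hx).trans ((le_max_left C 0).trans ?_)
    rw [mul_assoc]
    refine le_mul_of_one_le_right (le_max_right _ _) ?_
    rw [inv_mul_eq_div, one_le_div (by positivity)]
    exact Real.rpow_le_rpow hn.le hlt.le s.2

end Operators

/-! ### Embedded Hilbert spaces are determined by their underlying subspaces -/

namespace HilbertSub

variable {H : Type u} [NormedAddCommGroup H] [InnerProductSpace ℂ H]

/-- Closed graph theorem: the graph of the algebraic inclusion is the set where the two continuous
embeddings into `H` agree. Norm equivalences therefore never have to be computed. -/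
theorem embeds_of_carrier_le {X : HilbertSub.{u, v} H} {Y : HilbertSub.{u, w} H}
    (h : X.carrier ≤ Y.carrier) : X.Embeds Y := by
  let e : Y.E ≃ₗ[ℂ] Y.carrier := LinearEquiv.ofInjective Y.ι.toLinearMap Y.inj
  let j : X.E →ₗ[ℂ] Y.E :=
    e.symm.toLinearMap ∘ₗ X.ι.toLinearMap.codRestrict Y.carrier fun x => h ⟨x, rfl⟩
  have hj : ∀ x, Y.ι (j x) = X.ι x := fun x =>
    congrArg Subtype.val (e.apply_symm_apply ⟨X.ι x, h ⟨x, rfl⟩⟩)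
  have hcl : IsClosed (j.graph : Set (X.E × Y.E)) := by
    have : (j.graph : Set (X.E × Y.E)) = {p | Y.ι p.2 = X.ι p.1} := by
      ext ⟨x, y⟩
      simp only [SetLike.mem_coe, LinearMap.mem_graph_iff, Set.mem_ofPred_eq]
      exact ⟨fun h => by rw [h, hj], fun h => Y.inj (by rw [h, hj])⟩
    rw [this]
    exact isClosed_eq (by fun_prop) (by fun_prop)
  exact ⟨⟨j, j.continuous_of_isClosed_graph hcl⟩, hj⟩

theorem SameSpace.carrier_eq {X : HilbertSub.{u, v} H} {Y : HilbertSub.{u, w} H}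
    (h : X.SameSpace Y) : X.carrier = Y.carrier := by
  obtain ⟨e, he⟩ := h
  ext z
  constructor
  · rintro ⟨x, rfl⟩
    exact ⟨e x, he x⟩
  · rintro ⟨y, rfl⟩
    exact ⟨e.symm y, by simpa using (he (e.symm y)).symm⟩

theorem sameSpace_of_carrier_eq {X : HilbertSub.{u, v} H} {Y : HilbertSub.{u, w} H}
    (h : X.carrier = Y.carrier) : X.SameSpace Y := by
  obtain ⟨i, hi⟩ := embeds_of_carrier_le h.le
  obtain ⟨j, hj⟩ := embeds_of_carrier_le h.ge
  exact ⟨ContinuousLinearEquiv.equivOfInverse i j (fun x => X.inj (by rw [hj, hi]))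
    (fun y => Y.inj (by rw [hi, hj])), hi⟩

/-- The range of an injective bounded operator, with the norm transported from its source. -/
def ofRange {K : Type u} [NormedAddCommGroup K] [InnerProductSpace ℂ K] [CompleteSpace K]
    (T : K →L[ℂ] K) (hT : Function.Injective T) : HilbertSub.{u, u} K where
  E := K
  ι := T
  inj := hT

theorem SumSpace.toAmbient_mk {X : HilbertSub.{u, v} H} {Y : HilbertSub.{u, w} H} (x : X.E)
    (y : Y.E) : SumSpace.toAmbient X Y (SumSpace.mk X Y x y) = X.ι x + Y.ι y := rfl

theorem SumSpace.toAmbient_injective (X : HilbertSub.{u, v} H) (Y : HilbertSub.{u, w} H) :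
    Function.Injective (SumSpace.toAmbient X Y) :=
  LinearMap.ker_eq_bot.1 (Submodule.ker_liftQ_eq_bot _ _ _ le_rfl)

/-- The embedding of the sum space as a continuous linear map. -/
def SumSpace.toAmbientL (X : HilbertSub.{u, v} H) (Y : HilbertSub.{u, w} H) :
    SumSpace X Y →L[ℂ] H :=
  (sumKer X Y).liftQL (X.ι.coprod Y.ι) le_rfl

theorem SumSpace.toAmbientL_apply (X : HilbertSub.{u, v} H) (Y : HilbertSub.{u, w} H)
    (z : SumSpace X Y) : SumSpace.toAmbientL X Y z = SumSpace.toAmbient X Y z := rfl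

/-- The class map as a continuous linear map. -/
def SumSpace.mkL (X : HilbertSub.{u, v} H) (Y : HilbertSub.{u, w} H) :
    X.E × Y.E →L[ℂ] SumSpace X Y := (sumKer X Y).mkQL

end HilbertSub

/-! ### Complex powers of an injective positive contraction -/

section ComplexPowers

variable {K : Type*} [NormedAddCommGroup K] [InnerProductSpace ℂ K] [CompleteSpace K]

/-- The logarithm `log (max x (1 / (n + 1)))` of the truncated variable. -/
def truncLog (n : ℕ) (x : ℝ) : ℝ := Real.log (max x (1 / (n + 1)))

theorem max_trunc_pos (n : ℕ) (x : ℝ) : 0 < max x (1 / ((n : ℝ) + 1)) :=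
  lt_max_of_lt_right (by positivity)

@[fun_prop]
theorem continuous_truncLog (n : ℕ) : Continuous (truncLog n) := by
  unfold truncLog
  exact (by fun_prop : Continuous fun x : ℝ => max x (1 / ((n : ℝ) + 1))).log
    fun x => (max_trunc_pos n x).ne'

theorem truncLog_nonpos (n : ℕ) {x : ℝ} (hx : x ≤ 1) : truncLog n x ≤ 0 := by
  refine Real.log_nonpos (max_trunc_pos n x).le (max_le hx ?_)
  rw [div_le_one (by positivity)]
  linarith [(Nat.cast_nonneg n : (0 : ℝ) ≤ n)]

theorem exp_truncLog_mul (n : ℕ) (x r : ℝ) :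
    Real.exp (r * truncLog n x) = max x (1 / ((n : ℝ) + 1)) ^ r := by
  rw [Real.rpow_def_of_pos (max_trunc_pos n x), mul_comm]; rfl

/-- The bounded approximations `ζ ↦ max (w, 1 / (n + 1)) ^ ζ` of the complex powers of `w`. -/
def truncPow (w : K →L[ℂ] K) (n : ℕ) (ζ : ℂ) : K →L[ℂ] K :=
  NormedSpace.exp (ζ • cfc (truncLog n) w)

theorem differentiable_truncPow (w : K →L[ℂ] K) (n : ℕ) : Differentiable ℂ (truncPow w n) :=
  fun ζ => (hasDerivAt_exp_smul_const (𝕂 := ℂ) (cfc (truncLog n) w) ζ).differentiableAt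

@[fun_prop]
theorem continuous_truncPow_symbol (n : ℕ) (ζ : ℂ) :
    Continuous fun z : ℂ => Complex.exp (ζ * ((truncLog n z.re : ℝ) : ℂ)) := by
  have := continuous_truncLog n
  fun_prop

theorem truncPow_eq_cfc {w : K →L[ℂ] K} (hw : 0 ≤ w) (n : ℕ) (ζ : ℂ) :
    truncPow w n ζ = cfc (fun z : ℂ => Complex.exp (ζ * ((truncLog n z.re : ℝ) : ℂ))) w := by
  have hsa : IsSelfAdjoint w := .of_nonneg hw
  have := hsa.isStarNormal
  have hl : Continuous fun z : ℂ => ((truncLog n z.re : ℝ) : ℂ) := by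
    have := continuous_truncLog n
    fun_prop
  rw [cfc_comp' Complex.exp (fun z : ℂ => ζ * ((truncLog n z.re : ℝ) : ℂ)) w (by fun_prop)
    (by fun_prop), cfc_const_mul _ _ w (by fun_prop), ← cfc_real_eq_complex (truncLog n),
    CFC.complex_exp_eq_normedSpace_exp]
  rfl

theorem truncPow_zero (w : K →L[ℂ] K) (n : ℕ) : truncPow w n 0 = 1 := by
  simp [truncPow]

theorem truncPow_add (w : K →L[ℂ] K) (n : ℕ) (ζ η : ℂ) :
    truncPow w n (ζ + η) = truncPow w n ζ * truncPow w n η := by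
  let +nondep : NormedAlgebra ℚ (K →L[ℂ] K) := .restrictScalars ℚ ℂ _
  rw [truncPow, add_smul]
  exact NormedSpace.exp_add_of_commute (((Commute.refl _).smul_left ζ).smul_right η)

theorem norm_exp_mul_ofReal (ζ : ℂ) (l : ℝ) :
    ‖Complex.exp (ζ * (l : ℂ))‖ = Real.exp (ζ.re * l) := by
  simp [Complex.norm_exp]

theorem norm_truncPow_apply_le_mul {w : K →L[ℂ] K} (hw : 0 ≤ w) (n : ℕ) (ζ : ℂ) {C : ℝ}
    (hC : 0 ≤ C) (h : ∀ x ∈ spectrum ℝ w, Real.exp (ζ.re * truncLog n x) ≤ C) (v : K) :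
    ‖truncPow w n ζ v‖ ≤ C * ‖v‖ := by
  have hsa : IsSelfAdjoint w := .of_nonneg hw
  have := hsa.isStarNormal
  have h2 := norm_cfc_apply_le (n := w)
    (f := fun z : ℂ => Complex.exp (ζ * ((truncLog n z.re : ℝ) : ℂ)))
    (g := fun _ => 1) (by fun_prop) (by fun_prop) hC (fun z hz => by
      rw [norm_exp_mul_ofReal, norm_one, mul_one]
      exact h _ (re_mem_spectrum hsa hz)) v
  rw [cfc_const_one ℂ w, ← truncPow_eq_cfc hw] at h2
  simpa using h2

theorem norm_truncPow_apply_le {w : K →L[ℂ] K} (hw : 0 ≤ w) (hw1 : ‖w‖ ≤ 1) (n : ℕ) {ζ : ℂ}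
    (hζ : 0 ≤ ζ.re) (v : K) : ‖truncPow w n ζ v‖ ≤ ‖v‖ := by
  simpa using norm_truncPow_apply_le_mul hw n ζ zero_le_one (fun x hx => by
    rw [Real.exp_le_one_iff]
    exact mul_nonpos_of_nonneg_of_nonpos hζ (truncLog_nonpos n (spectrum_mem_Icc hw hw1 hx).2)) v

theorem exists_norm_truncPow_le {w : K →L[ℂ] K} (hw : 0 ≤ w) (n : ℕ) (N : ℝ) :
    ∃ C, 0 ≤ C ∧ ∀ ζ : ℂ, |ζ.re| ≤ N → ∀ v, ‖truncPow w n ζ v‖ ≤ C * ‖v‖ := by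
  obtain ⟨B, hB⟩ := (spectrum.isCompact (𝕜 := ℝ) w).exists_bound_of_continuousOn
    (continuous_truncLog n).continuousOn
  refine ⟨Real.exp (N * max B 0), (Real.exp_pos _).le, fun ζ hζ v => ?_⟩
  refine norm_truncPow_apply_le_mul hw n ζ (Real.exp_pos _).le (fun x hx => ?_) v
  refine Real.exp_le_exp.2 ((le_abs_self _).trans ?_)
  rw [abs_mul]
  exact mul_le_mul hζ ((hB x hx).trans (le_max_left _ _)) (abs_nonneg _)
    ((abs_nonneg _).trans hζ)

theorem rpow_eq_cfc_complex {w : K →L[ℂ] K} (hw : 0 ≤ w) (s : ℝ) :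
    w ^ s = cfc (fun z : ℂ => ((z.re ^ s : ℝ) : ℂ)) w := by
  have hsa : IsSelfAdjoint w := .of_nonneg hw
  rw [CFC.rpow_eq_cfc_real hw, cfc_real_eq_complex (fun x => x ^ s)]

theorem continuous_ofReal_re_rpow {s : ℝ} (hs : 0 ≤ s) :
    Continuous fun z : ℂ => ((z.re ^ s : ℝ) : ℂ) :=
  Complex.continuous_ofReal.comp ((Real.continuous_rpow_const hs).comp Complex.continuous_re)

/-- The symbol has modulus `(x / max x (1 / (n + 1)))^s ≤ 1`. The truncated power thus serves as an
approximate inverse of `w^s` with a bound independent of `n`. -/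
theorem norm_truncPow_rpow_apply_le {w : K →L[ℂ] K} (hw : 0 ≤ w) (n : ℕ) {s : ℝ}
    (hs : 0 ≤ s) {ζ : ℂ} (hζ : ζ.re = -s) (v : K) :
    ‖truncPow w n ζ ((w ^ s : K →L[ℂ] K) v)‖ ≤ ‖v‖ := by
  have hsa : IsSelfAdjoint w := .of_nonneg hw
  have := hsa.isStarNormal
  have hc := continuous_ofReal_re_rpow hs
  have h2 := norm_cfc_apply_le (n := w)
    (f := fun z : ℂ => Complex.exp (ζ * ((truncLog n z.re : ℝ) : ℂ)) * ((z.re ^ s : ℝ) : ℂ))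
    (g := fun _ => 1) (by fun_prop) (by fun_prop) zero_le_one (fun z hz => by
      have hx := spectrum_nonneg_of_nonneg hw (re_mem_spectrum hsa hz)
      rw [norm_mul, norm_exp_mul_ofReal, norm_one, mul_one, hζ, exp_truncLog_mul,
        Complex.norm_real, Real.norm_eq_abs, abs_of_nonneg (Real.rpow_nonneg hx _),
        Real.rpow_neg (max_trunc_pos n _).le, inv_mul_le_one₀ (Real.rpow_pos_of_pos
          (max_trunc_pos n _) _)]
      exact Real.rpow_le_rpow hx (le_max_left _ _) hs) v
  rw [cfc_const_one ℂ w, cfc_mul _ _ w (by fun_prop) (by fun_prop), ← truncPow_eq_cfc hw,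
    ← rpow_eq_cfc_complex hw] at h2
  simpa using h2

/-- The two symbols agree for `x ≥ 1 / (N + 1)`. Below that point each exponential has modulus at
most `1`, and the extra factor `w` contributes `x < 1 / (N + 1)`. The estimate is uniform in `ζ`. -/
theorem norm_truncPow_sub_apply_le {w : K →L[ℂ] K} (hw : 0 ≤ w) (hw1 : ‖w‖ ≤ 1) {N m n : ℕ}
    (hm : N ≤ m) (hn : N ≤ n) {ζ : ℂ} (hζ : 0 ≤ ζ.re) (v : K) :
    ‖truncPow w n ζ (w v) - truncPow w m ζ (w v)‖ ≤ 2 / ((N : ℝ) + 1) * ‖v‖ := by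
  have hsa : IsSelfAdjoint w := .of_nonneg hw
  have := hsa.isStarNormal
  have hN : ∀ {n : ℕ}, N ≤ n → (1 : ℝ) / (n + 1) ≤ 1 / (N + 1) := fun h =>
    one_div_le_one_div_of_le (by positivity) (by gcongr)
  have h2 := norm_cfc_apply_le (n := w)
    (f := fun z : ℂ => (Complex.exp (ζ * ((truncLog n z.re : ℝ) : ℂ)) -
      Complex.exp (ζ * ((truncLog m z.re : ℝ) : ℂ))) * z)
    (g := fun _ => 1) (C := 2 / ((N : ℝ) + 1)) (by fun_prop) (by fun_prop) (by positivity)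
    (fun z hz => by
      have hx := spectrum_mem_Icc hw hw1 (re_mem_spectrum hsa hz)
      have hzr : z = (z.re : ℂ) := by
        simpa using (SpectrumRestricts.real_iff.mp hsa.spectrumRestricts _ hz)
      rw [norm_one, mul_one, norm_mul]
      have hnz : ‖z‖ = z.re := by
        rw [hzr, Complex.norm_real, Real.norm_of_nonneg hx.1, Complex.ofReal_re]
      rw [hnz]
      rcases le_or_gt (1 / ((N : ℝ) + 1)) z.re with hle | hlt
      · have : truncLog n z.re = truncLog m z.re := by
          rw [truncLog, truncLog, max_eq_left ((hN hn).trans hle), max_eq_left ((hN hm).trans hle)]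
        rw [this, sub_self, norm_zero, zero_mul]
        positivity
      · rw [show (2 : ℝ) / (N + 1) = 2 * (1 / (N + 1)) by ring]
        refine mul_le_mul ((norm_sub_le _ _).trans ?_) hlt.le hx.1 zero_le_two
        have : ∀ k, ‖Complex.exp (ζ * ((truncLog k z.re : ℝ) : ℂ))‖ ≤ 1 := fun k => by
          rw [norm_exp_mul_ofReal, Real.exp_le_one_iff]
          exact mul_nonpos_of_nonneg_of_nonpos hζ (truncLog_nonpos k hx.2)
        linarith [this n, this m]) v
  rw [cfc_const_one ℂ w, cfc_mul _ _ w (by fun_prop) (by fun_prop),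
    cfc_sub _ _ w (by fun_prop) (by fun_prop), ← truncPow_eq_cfc hw, ← truncPow_eq_cfc hw,
    cfc_id' ℂ w] at h2
  simpa using h2

theorem norm_truncPow_sub_rpow_apply_le {w : K →L[ℂ] K} (hw : 0 ≤ w) (hw1 : ‖w‖ ≤ 1) (n : ℕ)
    {r : ℝ} (hr : 0 ≤ r) (v : K) :
    ‖truncPow w n r (w v) - (w ^ r : K →L[ℂ] K) (w v)‖ ≤ 2 / ((n : ℝ) + 1) * ‖v‖ := by
  have hsa : IsSelfAdjoint w := .of_nonneg hw
  have := hsa.isStarNormal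
  have hc := continuous_ofReal_re_rpow hr
  have h2 := norm_cfc_apply_le (n := w)
    (f := fun z : ℂ => (Complex.exp (r * ((truncLog n z.re : ℝ) : ℂ)) -
      ((z.re ^ r : ℝ) : ℂ)) * z)
    (g := fun _ => 1) (C := 2 / ((n : ℝ) + 1)) (by fun_prop) (by fun_prop) (by positivity)
    (fun z hz => by
      have hx := spectrum_mem_Icc hw hw1 (re_mem_spectrum hsa hz)
      have hzr : z = (z.re : ℂ) := by
        simpa using (SpectrumRestricts.real_iff.mp hsa.spectrumRestricts _ hz)
      rw [norm_one, mul_one, norm_mul]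
      have hnz : ‖z‖ = z.re := by
        rw [hzr, Complex.norm_real, Real.norm_of_nonneg hx.1, Complex.ofReal_re]
      rw [hnz]
      rcases le_or_gt (1 / ((n : ℝ) + 1)) z.re with hle | hlt
      · have : Complex.exp (r * ((truncLog n z.re : ℝ) : ℂ)) = ((z.re ^ r : ℝ) : ℂ) := by
          rw [← Complex.ofReal_mul, ← Complex.ofReal_exp, exp_truncLog_mul, max_eq_left hle]
        rw [this, sub_self, norm_zero, zero_mul]
        positivity
      · rw [show (2 : ℝ) / (n + 1) = 2 * (1 / (n + 1)) by ring]
        refine mul_le_mul ((norm_sub_le _ _).trans ?_) hlt.le hx.1 zero_le_two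
        have h3 : ‖Complex.exp (r * ((truncLog n z.re : ℝ) : ℂ))‖ ≤ 1 := by
          rw [norm_exp_mul_ofReal, Real.exp_le_one_iff]
          exact mul_nonpos_of_nonneg_of_nonpos (by simpa using hr) (truncLog_nonpos n hx.2)
        have h4 : ‖((z.re ^ r : ℝ) : ℂ)‖ ≤ 1 := by
          rw [Complex.norm_real, Real.norm_of_nonneg (Real.rpow_nonneg hx.1 _)]
          exact Real.rpow_le_one hx.1 hx.2 hr
        linarith) v
  rw [cfc_const_one ℂ w, cfc_mul _ _ w (by fun_prop) (by fun_prop),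
    cfc_sub _ _ w (by fun_prop) (by fun_prop), ← truncPow_eq_cfc hw, ← rpow_eq_cfc_complex hw,
    cfc_id' ℂ w] at h2
  simpa using h2

theorem norm_rpow_apply_le {w : K →L[ℂ] K} (hw : 0 ≤ w) (hw1 : ‖w‖ ≤ 1) {r : ℝ} (hr : 0 ≤ r)
    (v : K) : ‖(w ^ r : K →L[ℂ] K) v‖ ≤ ‖v‖ := by
  have h2 := norm_cfc_real_apply_le (.of_nonneg hw : IsSelfAdjoint w) (f := fun x => x ^ r)
    (g := fun _ => 1) (Real.continuous_rpow_const hr).continuousOn (by fun_prop) zero_le_one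
    (fun x hx => by
      have hx := spectrum_mem_Icc hw hw1 hx
      rw [abs_of_nonneg (Real.rpow_nonneg hx.1 _), abs_one, mul_one]
      exact Real.rpow_le_one hx.1 hx.2 hr) v
  rw [cfc_const_one ℝ w, ← CFC.rpow_eq_cfc_real hw] at h2
  simpa using h2

theorem tendsto_truncPow_rpow {w : K →L[ℂ] K} (hw : 0 ≤ w) (hw1 : ‖w‖ ≤ 1)
    (hi : Function.Injective w) {r : ℝ} (hr : 0 ≤ r) (v : K) :
    Filter.Tendsto (fun n => truncPow w n r v) Filter.atTop (nhds ((w ^ r : K →L[ℂ] K) v)) := by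
  rw [Metric.tendsto_atTop]
  intro ε hε
  obtain ⟨u, hu⟩ := (denseRange_of_isSelfAdjoint (.of_nonneg hw) hi).exists_dist_lt v
    (show 0 < ε / 3 by positivity)
  have hlim : Filter.Tendsto (fun n : ℕ => 2 / ((n : ℝ) + 1) * ‖u‖) Filter.atTop (nhds 0) := by
    simpa [div_eq_mul_inv, mul_assoc] using
      ((tendsto_one_div_add_atTop_nhds_zero_nat (𝕜 := ℝ)).const_mul 2).mul_const ‖u‖
  obtain ⟨N, hN⟩ := (hlim.eventually_lt_const (show 0 < ε / 3 by positivity)).exists_forall_of_atTop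
  refine ⟨N, fun n hn => ?_⟩
  rw [dist_eq_norm] at hu ⊢
  have e : truncPow w n r v - (w ^ r : K →L[ℂ] K) v = truncPow w n r (v - w u) +
      (truncPow w n r (w u) - (w ^ r : K →L[ℂ] K) (w u)) - (w ^ r : K →L[ℂ] K) (v - w u) := by
    simp only [map_sub]; abel
  rw [e]
  refine (norm_sub_le _ _).trans_lt ?_
  have h1 := norm_add_le (truncPow w n r (v - w u))
    (truncPow w n r (w u) - (w ^ r : K →L[ℂ] K) (w u))
  have h2 := norm_truncPow_apply_le hw hw1 n (ζ := r) (by simpa using hr) (v - w u)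
  have h3 := norm_truncPow_sub_rpow_apply_le hw hw1 n hr u
  have h4 := norm_rpow_apply_le hw hw1 hr (v - w u)
  linarith [hN n hn]

/-- An `ε/3` argument: the estimate holds on the dense range of `w`, and the truncated powers are
contractions. Uniformity on the closed half-plane is what makes the limit continuous up to the
imaginary axis and holomorphic inside. -/
theorem uniformCauchySeqOn_truncPow {w : K →L[ℂ] K} (hw : 0 ≤ w) (hw1 : ‖w‖ ≤ 1)
    (hi : Function.Injective w) (k : K) :
    UniformCauchySeqOn (fun n ζ => truncPow w n ζ k) Filter.atTop {ζ : ℂ | 0 ≤ ζ.re} := by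
  rw [Metric.uniformCauchySeqOn_iff]
  intro ε hε
  obtain ⟨u, hu⟩ := (denseRange_of_isSelfAdjoint (.of_nonneg hw) hi).exists_dist_lt k
    (show 0 < ε / 3 by positivity)
  have hlim : Filter.Tendsto (fun n : ℕ => 2 / ((n : ℝ) + 1) * ‖u‖) Filter.atTop (nhds 0) := by
    simpa [div_eq_mul_inv, mul_assoc] using
      ((tendsto_one_div_add_atTop_nhds_zero_nat (𝕜 := ℝ)).const_mul 2).mul_const ‖u‖
  obtain ⟨N, hN⟩ := (hlim.eventually_lt_const (show 0 < ε / 3 by positivity)).exists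
  refine ⟨N, fun m hm n hn ζ hζ => ?_⟩
  rw [dist_eq_norm] at hu ⊢
  have e : truncPow w m ζ k - truncPow w n ζ k = truncPow w m ζ (k - w u) +
      (truncPow w m ζ (w u) - truncPow w n ζ (w u)) - truncPow w n ζ (k - w u) := by
    simp only [map_sub]; abel
  rw [e]
  refine (norm_sub_le _ _).trans_lt ?_
  have h1 := norm_add_le (truncPow w m ζ (k - w u)) (truncPow w m ζ (w u) - truncPow w n ζ (w u))
  have h2 := norm_truncPow_apply_le hw hw1 m hζ (k - w u)
  have h3 := norm_truncPow_sub_apply_le hw hw1 hn hm hζ u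
  have h4 := norm_truncPow_apply_le hw hw1 n hζ (k - w u)
  linarith

/-- The complex power `w ^ ζ` for `0 ≤ Re ζ`, as the strong limit of its approximations. -/
def complexPow (w : K →L[ℂ] K) (ζ : ℂ) (k : K) : K :=
  Filter.limUnder Filter.atTop fun n => truncPow w n ζ k

theorem tendsto_complexPow {w : K →L[ℂ] K} (hw : 0 ≤ w) (hw1 : ‖w‖ ≤ 1)
    (hi : Function.Injective w) {ζ : ℂ} (hζ : 0 ≤ ζ.re) (k : K) :
    Filter.Tendsto (fun n => truncPow w n ζ k) Filter.atTop (nhds (complexPow w ζ k)) :=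
  ((uniformCauchySeqOn_truncPow hw hw1 hi k).cauchySeq hζ).tendsto_limUnder

theorem tendstoUniformlyOn_complexPow {w : K →L[ℂ] K} (hw : 0 ≤ w) (hw1 : ‖w‖ ≤ 1)
    (hi : Function.Injective w) (k : K) :
    TendstoUniformlyOn (fun n ζ => truncPow w n ζ k) (fun ζ => complexPow w ζ k) Filter.atTop
      {ζ : ℂ | 0 ≤ ζ.re} :=
  (uniformCauchySeqOn_truncPow hw hw1 hi k).tendstoUniformlyOn_of_tendsto
    fun _ hζ => tendsto_complexPow hw hw1 hi hζ k

theorem continuousOn_complexPow {w : K →L[ℂ] K} (hw : 0 ≤ w) (hw1 : ‖w‖ ≤ 1)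
    (hi : Function.Injective w) (k : K) :
    ContinuousOn (fun ζ => complexPow w ζ k) {ζ : ℂ | 0 ≤ ζ.re} :=
  (tendstoUniformlyOn_complexPow hw hw1 hi k).continuousOn (Filter.Frequently.of_forall fun n =>
    ((differentiable_truncPow w n).continuous.clm_apply continuous_const).continuousOn)

theorem differentiableOn_complexPow {w : K →L[ℂ] K} (hw : 0 ≤ w) (hw1 : ‖w‖ ≤ 1)
    (hi : Function.Injective w) (k : K) :
    DifferentiableOn ℂ (fun ζ => complexPow w ζ k) {ζ : ℂ | 0 < ζ.re} := by
  refine TendstoLocallyUniformlyOn.differentiableOn (F := fun n ζ => truncPow w n ζ k)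
    (φ := Filter.atTop) ?_ (Filter.Eventually.of_forall fun n => ?_)
    (isOpen_lt continuous_const Complex.continuous_re)
  · exact ((tendstoUniformlyOn_complexPow hw hw1 hi k).mono
      (fun ζ (hζ : 0 < ζ.re) => hζ.le)).tendstoLocallyUniformlyOn
  · exact ((differentiable_truncPow w n).clm_apply (differentiable_const k)).differentiableOn

theorem norm_complexPow_le {w : K →L[ℂ] K} (hw : 0 ≤ w) (hw1 : ‖w‖ ≤ 1)
    (hi : Function.Injective w) {ζ : ℂ} (hζ : 0 ≤ ζ.re) (k : K) : ‖complexPow w ζ k‖ ≤ ‖k‖ :=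
  le_of_tendsto (tendsto_complexPow hw hw1 hi hζ k).norm
    (Filter.Eventually.of_forall fun n => norm_truncPow_apply_le hw hw1 n hζ k)

theorem complexPow_zero (w : K →L[ℂ] K) (k : K) : complexPow w 0 k = k := by
  simp only [complexPow, truncPow_zero]
  exact tendsto_const_nhds.limUnder_eq

/-- The law holds for the truncations. In the limit both the operator and its argument vary, and
contractivity of `truncPow w n r` controls the change of argument. -/
theorem complexPow_ofReal_add {w : K →L[ℂ] K} (hw : 0 ≤ w) (hw1 : ‖w‖ ≤ 1)
    (hi : Function.Injective w) {r : ℝ} (hr : 0 ≤ r) {ζ : ℂ} (hζ : 0 ≤ ζ.re) (k : K) :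
    complexPow w (r + ζ) k = (w ^ r : K →L[ℂ] K) (complexPow w ζ k) := by
  refine tendsto_nhds_unique (tendsto_complexPow hw hw1 hi (by simp; linarith) k) ?_
  have h1 := tendsto_truncPow_rpow hw hw1 hi hr (complexPow w ζ k)
  have h2 : Filter.Tendsto (fun n => truncPow w n r (truncPow w n ζ k - complexPow w ζ k))
      Filter.atTop (nhds 0) := by
    refine squeeze_zero_norm (fun n => norm_truncPow_apply_le hw hw1 n (by simpa using hr) _) ?_
    exact tendsto_iff_norm_sub_tendsto_zero.1 (tendsto_complexPow hw hw1 hi hζ k)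
  have h3 := h2.add h1
  rw [zero_add] at h3
  refine h3.congr fun n => ?_
  rw [truncPow_add, mul_apply_eq_comp, map_sub, sub_add_cancel]

theorem complexPow_ofReal {w : K →L[ℂ] K} (hw : 0 ≤ w) (hw1 : ‖w‖ ≤ 1)
    (hi : Function.Injective w) {r : ℝ} (hr : 0 ≤ r) (k : K) :
    complexPow w r k = (w ^ r : K →L[ℂ] K) k := by
  have := complexPow_ofReal_add hw hw1 hi hr (ζ := 0) (by simp) k
  rwa [add_zero, complexPow_zero] at this

end ComplexPowers

/-! ### Complex interpolation between ranges of powers -/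

namespace HilbertSub

open Complex.HadamardThreeLines

variable {K : Type u} [NormedAddCommGroup K] [InnerProductSpace ℂ K] [CompleteSpace K]

theorem exists_lift_of_range_le {T : K →L[ℂ] K} (hT : Function.Injective T)
    {X : HilbertSub.{u, v} K} (h : T.range ≤ X.carrier) :
    ∃ j : K →L[ℂ] X.E, ∀ k, X.ι (j k) = T k :=
  embeds_of_carrier_le (X := ofRange T hT) (Y := X) h

theorem exists_lift_of_le_range {T : K →L[ℂ] K} (hT : Function.Injective T)
    {X : HilbertSub.{u, v} K} (h : X.carrier ≤ T.range) :
    ∃ j : X.E →L[ℂ] K, ∀ x, T (j x) = X.ι x :=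
  embeds_of_carrier_le (X := X) (Y := ofRange T hT) h

theorem tendsto_exp_sub_sq_cocompact (a : ℝ) :
    Filter.Tendsto (fun y : ℝ => Real.exp (a - y ^ 2)) (Filter.cocompact ℝ) (nhds 0) := by
  refine Real.tendsto_exp_atBot.comp ?_
  have h : Filter.Tendsto (fun y : ℝ => y ^ 2) (Filter.cocompact ℝ) Filter.atTop := by
    have := (Filter.tendsto_pow_atTop (α := ℝ) two_ne_zero).comp
      (tendsto_norm_cocompact_atTop (E := ℝ))
    refine this.congr fun y => ?_
    simp
  exact (tendsto_const_nhds (x := a)).add_atBot (Filter.tendsto_neg_atTop_atBot.comp h) |>.congr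
    fun y => by simp [sub_eq_add_neg]

theorem norm_exp_sq_le {a b : ℝ} (ha : |a| ≤ 1) :
    ‖Complex.exp (((a : ℂ) + b * Complex.I) ^ 2)‖ ≤ Real.exp (1 - b ^ 2) := by
  rw [Complex.norm_exp, Real.exp_le_exp]
  have : ((((a : ℂ) + b * Complex.I) ^ 2).re) = a ^ 2 - b ^ 2 := by
    simp [pow_two]
  rw [this]
  have := sq_abs a
  nlinarith [abs_nonneg a]

/-- The function `y ↦ exp ((a + iy)²) j (w ^ (iσy) k)`. -/
def boundaryFun {w : K →L[ℂ] K} (hw : 0 ≤ w) (hw1 : ‖w‖ ≤ 1) (hi : Function.Injective w)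
    {E : Type*} [NormedAddCommGroup E] [InnerProductSpace ℂ E] (j : K →L[ℂ] E) (k : K) (σ : ℝ)
    {a : ℝ} (ha : |a| ≤ 1) : C₀(ℝ, E) where
  toFun y := Complex.exp (((a : ℂ) + y * Complex.I) ^ 2) •
    j (complexPow w (((y * σ : ℝ) : ℂ) * Complex.I) k)
  continuous_toFun := by
    refine Continuous.smul (by fun_prop) (j.continuous.comp ?_)
    exact (continuousOn_complexPow hw hw1 hi k).comp_continuous (by fun_prop) fun y => by simp
  zero_at_infty' := by
    refine squeeze_zero_norm (a := fun y : ℝ => Real.exp (1 - y ^ 2) * (‖j‖ * ‖k‖)) (fun y => ?_) ?_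
    · rw [norm_smul]
      refine mul_le_mul (norm_exp_sq_le ha) ((j.le_opNorm _).trans ?_) (norm_nonneg _)
        (Real.exp_pos _).le
      exact mul_le_mul_of_nonneg_left (norm_complexPow_le hw hw1 hi (by simp) k) (norm_nonneg _)
    · simpa using (tendsto_exp_sub_sq_cocompact 1).mul_const (‖j‖ * ‖k‖)

theorem norm_boundaryFun_le {w : K →L[ℂ] K} (hw : 0 ≤ w) (hw1 : ‖w‖ ≤ 1)
    (hi : Function.Injective w) {E : Type*} [NormedAddCommGroup E] [InnerProductSpace ℂ E]
    (j : K →L[ℂ] E) (k : K) (σ : ℝ) {a : ℝ} (ha : |a| ≤ 1) :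
    ‖boundaryFun hw hw1 hi j k σ ha‖ ≤ Real.exp 1 * ‖j‖ * ‖k‖ := by
  rw [← ZeroAtInftyContinuousMap.norm_toBCF_eq_norm]
  refine (BoundedContinuousFunction.norm_le (by positivity)).2 fun y => ?_
  change ‖Complex.exp (((a : ℂ) + y * Complex.I) ^ 2) •
    j (complexPow w (((y * σ : ℝ) : ℂ) * Complex.I) k)‖ ≤ _
  rw [norm_smul, mul_assoc]
  refine mul_le_mul ((norm_exp_sq_le ha).trans (Real.exp_le_exp.2 (by nlinarith)))
    ((j.le_opNorm _).trans ?_) (norm_nonneg _) (Real.exp_pos _).le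
  exact mul_le_mul_of_nonneg_left (norm_complexPow_le hw hw1 hi (by simp) k) (norm_nonneg _)

/-- The range of `w ^ min s t` is one of the two spaces, so it lifts continuously to the sum.
Admissible functions are built by composing this lift with bounded complex powers. -/
theorem exists_sumSpace_lift {w : K →L[ℂ] K} (hw : 0 ≤ w) (hi : Function.Injective w)
    {X : HilbertSub.{u, v} K} {Y : HilbertSub.{u, w} K} {s t : ℝ} (hs : 0 ≤ s) (ht : 0 ≤ t)
    (hX : X.carrier = (w ^ s : K →L[ℂ] K).range) (hY : Y.carrier = (w ^ t : K →L[ℂ] K).range) :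
    ∃ J : K →L[ℂ] SumSpace X Y,
      ∀ k, SumSpace.toAmbient X Y (J k) = (w ^ min s t : K →L[ℂ] K) k := by
  rcases le_total s t with h | h
  · obtain ⟨j, hj⟩ := exists_lift_of_range_le (rpow_injective_of_nonneg hw hi hs) hX.ge
    refine ⟨SumSpace.mkL X Y ∘L ContinuousLinearMap.inl ℂ X.E Y.E ∘L j, fun k => ?_⟩
    change SumSpace.toAmbient X Y (SumSpace.mk X Y (j k) 0) = _
    rw [SumSpace.toAmbient_mk, map_zero, add_zero, hj, min_eq_left h]
  · obtain ⟨j, hj⟩ := exists_lift_of_range_le (rpow_injective_of_nonneg hw hi ht) hY.ge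
    refine ⟨SumSpace.mkL X Y ∘L ContinuousLinearMap.inr ℂ X.E Y.E ∘L j, fun k => ?_⟩
    change SumSpace.toAmbient X Y (SumSpace.mk X Y 0 (j k)) = _
    rw [SumSpace.toAmbient_mk, map_zero, zero_add, hj, min_eq_right h]

/-- The function is `exp((z - θ)²) w^((1-z)s + zt) k`. The factor `w^m`, `m = min s t`, is absorbed
into `J`, leaving the exponent `ρ z` with nonnegative real part. The Gaussian equals `1` at `θ` and
supplies the decay on both boundary lines, where the unitary-type factor `w^(iy(t-s))` has none. -/
theorem exists_calderonFun {w : K →L[ℂ] K} (hw : 0 ≤ w) (hw1 : ‖w‖ ≤ 1)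
    (hi : Function.Injective w) {X : HilbertSub.{u, v} K} {Y : HilbertSub.{u, w} K} {s t θ : ℝ}
    (hs : 0 ≤ s) (ht : 0 ≤ t) (hθ0 : 0 ≤ θ) (hθ1 : θ ≤ 1)
    (hX : X.carrier = (w ^ s : K →L[ℂ] K).range) (hY : Y.carrier = (w ^ t : K →L[ℂ] K).range) :
    ∃ C, 0 ≤ C ∧ ∀ k, ∃ f : CalderonFun X Y,
      SumSpace.toAmbient X Y (f.F θ) = (w ^ (θ * t + (1 - θ) * s) : K →L[ℂ] K) k ∧
        max ‖f.left‖ ‖f.right‖ ≤ C * ‖k‖ := by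
  obtain ⟨jX, hjX⟩ := exists_lift_of_range_le (rpow_injective_of_nonneg hw hi hs) hX.ge
  obtain ⟨jY, hjY⟩ := exists_lift_of_range_le (rpow_injective_of_nonneg hw hi ht) hY.ge
  obtain ⟨J, hJ⟩ := exists_sumSpace_lift hw hi hs ht hX hY
  set m := min s t with hm
  have hm0 : 0 ≤ m := le_min hs ht
  have hms : 0 ≤ s - m := sub_nonneg.2 (min_le_left _ _)
  have hmt : 0 ≤ t - m := sub_nonneg.2 (min_le_right _ _)
  set ρ : ℂ → ℂ := fun z => (1 - z) * ((s - m : ℝ) : ℂ) + z * ((t - m : ℝ) : ℂ) with hρ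
  have hρre : ∀ z, (ρ z).re = (1 - z.re) * (s - m) + z.re * (t - m) := fun z => by
    simp only [hρ, Complex.add_re, Complex.re_mul_ofReal, Complex.sub_re, Complex.one_re]
  have hρ0 : ∀ z ∈ verticalClosedStrip 0 1, 0 ≤ (ρ z).re := fun z hz => by
    have h0 : 0 ≤ z.re := hz.1
    have h1 : z.re ≤ 1 := hz.2
    rw [hρre]
    have := sub_nonneg.2 h1
    positivity
  have hρc : Continuous ρ := by fun_prop
  have hρd : Differentiable ℂ ρ := by fun_prop
  have hθa : |-θ| ≤ 1 := by rw [abs_neg, abs_of_nonneg hθ0]; exact hθ1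
  have hθb : |1 - θ| ≤ 1 := by rw [abs_of_nonneg (by linarith)]; linarith
  have hcl : closure (verticalStrip 0 1) = verticalClosedStrip 0 1 := by
    rw [verticalClosedStrip, ← closure_Ioo zero_ne_one, ← Complex.closure_preimage_re]; rfl
  refine ⟨max (Real.exp 1 * ‖jX‖) (Real.exp 1 * ‖jY‖), by positivity, fun k => ?_⟩
  -- Holomorphy of `complexPow` is available only for positive real part. In the open strip `ρ` has
  -- positive real part unless `s = t`, and then `ρ` vanishes identically.
  have hdiff : DifferentiableOn ℂ (fun z => complexPow w (ρ z) k) (verticalStrip 0 1) := by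
    by_cases hst : s = t
    · have : ρ = fun _ => 0 := by
        funext z
        simp [hρ, hm, hst]
      simp only [this]
      exact differentiableOn_const _
    · refine (differentiableOn_complexPow hw hw1 hi k).comp hρd.differentiableOn fun z hz => ?_
      have h0 : 0 < z.re := hz.1
      have h1 : z.re < 1 := hz.2
      change 0 < (ρ z).re
      rw [hρre]
      rcases lt_or_gt_of_ne hst with h | h
      · have : 0 < t - m := by rw [hm, min_eq_left h.le]; linarith
        nlinarith
      · have : 0 < s - m := by rw [hm, min_eq_right h.le]; linarith
        nlinarith
  have hpow : ∀ {q : ℝ}, 0 ≤ q - m → ∀ y : ℝ,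
      (w ^ m : K →L[ℂ] K) (complexPow w (((q - m : ℝ) : ℂ) +
        ((y * (t - s) : ℝ) : ℂ) * Complex.I) k) =
      (w ^ q : K →L[ℂ] K) (complexPow w (((y * (t - s) : ℝ) : ℂ) * Complex.I) k) := by
    intro q hq y
    rw [complexPow_ofReal_add hw hw1 hi hq (by simp), ← mul_apply_eq_comp,
      ← rpow_add_eq_mul hm0 hq, add_sub_cancel]
  refine ⟨{ F := fun z => Complex.exp ((z - θ) ^ 2) • J (complexPow w (ρ z) k)
            left := boundaryFun hw hw1 hi jX k (t - s) hθa
            right := boundaryFun hw hw1 hi jY k (t - s) hθb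
            diffContOnCl := ⟨?_, ?_⟩
            bounded := ⟨Real.exp 1 * (‖J‖ * ‖k‖), ?_⟩
            left_eq := ?_
            right_eq := ?_ }, ?_, ?_⟩
  · have hE : Differentiable ℂ fun z : ℂ => Complex.exp ((z - θ) ^ 2) := by fun_prop
    exact hE.differentiableOn.smul (J.differentiable.comp_differentiableOn hdiff)
  · rw [hcl]
    have hE : Continuous fun z : ℂ => Complex.exp ((z - θ) ^ 2) := by fun_prop
    refine hE.continuousOn.smul (J.continuous.comp_continuousOn ?_)
    exact (continuousOn_complexPow hw hw1 hi k).comp hρc.continuousOn hρ0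
  · intro z hz
    rw [norm_smul]
    have h0 : 0 ≤ z.re := hz.1
    have h1 : z.re ≤ 1 := hz.2
    refine mul_le_mul ?_ ((J.le_opNorm _).trans (mul_le_mul_of_nonneg_left
      (norm_complexPow_le hw hw1 hi (hρ0 z hz) k) (norm_nonneg _))) (norm_nonneg _)
      (Real.exp_pos _).le
    have : z - θ = ((z.re - θ : ℝ) : ℂ) + (z.im : ℂ) * Complex.I := by
      conv_lhs => rw [← Complex.re_add_im z]
      push_cast; ring
    rw [this]
    refine (norm_exp_sq_le ?_).trans (Real.exp_le_exp.2 (by nlinarith))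
    rw [abs_le]; constructor <;> linarith
  · intro y
    apply SumSpace.toAmbient_injective
    change SumSpace.toAmbient X Y (_ • J _) = SumSpace.toAmbient X Y (SumSpace.mk X Y
      (Complex.exp ((((-θ : ℝ) : ℂ) + y * Complex.I) ^ 2) •
        jX (complexPow w (((y * (t - s) : ℝ) : ℂ) * Complex.I) k)) 0)
    rw [map_smul, hJ, SumSpace.toAmbient_mk, map_zero, add_zero, map_smul, hjX, ← hpow hms y]
    congr 3
    · push_cast; ring
    · simp only [hρ]; push_cast; ring_nf
  · intro y
    apply SumSpace.toAmbient_injective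
    change SumSpace.toAmbient X Y (_ • J _) = SumSpace.toAmbient X Y (SumSpace.mk X Y 0
      (Complex.exp ((((1 - θ : ℝ) : ℂ) + y * Complex.I) ^ 2) •
        jY (complexPow w (((y * (t - s) : ℝ) : ℂ) * Complex.I) k)))
    rw [map_smul, hJ, SumSpace.toAmbient_mk, map_zero, zero_add, map_smul, hjY, ← hpow hmt y]
    congr 3
    · push_cast; ring
    · simp only [hρ]; push_cast; ring_nf
  · have hr : ρ θ = (((1 - θ) * (s - m) + θ * (t - m) : ℝ) : ℂ) := by
      simp only [hρ]; push_cast; ring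
    have hr0 : 0 ≤ (1 - θ) * (s - m) + θ * (t - m) := by
      have := sub_nonneg.2 hθ1
      positivity
    change SumSpace.toAmbient X Y (_ • J _) = _
    rw [map_smul, hJ, hr, complexPow_ofReal hw hw1 hi hr0, ← mul_apply_eq_comp,
      ← rpow_add_eq_mul hm0 hr0]
    simp only [sub_self, ne_eq, OfNat.ofNat_ne_zero, not_false_eq_true, zero_pow, Complex.exp_zero,
      one_smul]
    congr 2
    ring_nf
  · rw [max_mul_of_nonneg _ _ (norm_nonneg k)]
    exact max_le_max (norm_boundaryFun_le hw hw1 hi jX k (t - s) hθa)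
      (norm_boundaryFun_le hw hw1 hi jY k (t - s) hθb)

theorem isSelfAdjoint_truncPow_ofReal {w : K →L[ℂ] K} (hw : 0 ≤ w) (n : ℕ) (r : ℝ) :
    IsSelfAdjoint (truncPow w n r) := by
  rw [truncPow_eq_cfc hw, IsSelfAdjoint, ← cfc_star]
  refine cfc_congr fun z _ => ?_
  simp only [← Complex.ofReal_mul, ← Complex.ofReal_exp, Complex.star_def, Complex.conj_ofReal]

/-- Three lines theorem for `z ↦ w_n^(-(zt + (1-z)s)) F(z)`, with `w_n` the truncation. On the
boundary `F` is `w^s` or `w^t` applied to a vector of norm at most `M`, and the truncated negative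
power composed with it is a contraction. Hence the bound does not depend on `n`. -/
theorem norm_truncPow_neg_apply_le {w : K →L[ℂ] K} (hw : 0 ≤ w) (n : ℕ)
    {X : HilbertSub.{u, v} K} {Y : HilbertSub.{u, w} K} {s t θ M : ℝ}
    (hs : 0 ≤ s) (ht : 0 ≤ t) (hθ0 : 0 ≤ θ) (hθ1 : θ ≤ 1)
    {dX : X.E →L[ℂ] K} (hdX : ∀ x, (w ^ s : K →L[ℂ] K) (dX x) = X.ι x)
    {dY : Y.E →L[ℂ] K} (hdY : ∀ y, (w ^ t : K →L[ℂ] K) (dY y) = Y.ι y) (f : CalderonFun X Y)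
    (hMX : ‖dX‖ * ‖f.left‖ ≤ M) (hMY : ‖dY‖ * ‖f.right‖ ≤ M) :
    ‖truncPow w n ((-(θ * t + (1 - θ) * s) : ℝ) : ℂ) (SumSpace.toAmbient X Y (f.F θ))‖ ≤ M := by
  have hM : 0 ≤ M := le_trans (by positivity) hMX
  set η : ℂ → ℂ := fun z => -(z * t + (1 - z) * s) with hη
  have hηre : ∀ z, (η z).re = -(z.re * t + (1 - z.re) * s) := fun z => by
    simp only [hη, Complex.neg_re, Complex.add_re, Complex.re_mul_ofReal, Complex.sub_re,
      Complex.one_re]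
  -- This constant depends on `n`, which is harmless: it only supplies the a priori boundedness on
  -- the strip required by the three lines theorem.
  obtain ⟨C, hC0, hC⟩ := exists_norm_truncPow_le hw n (s + t)
  obtain ⟨D, hD⟩ := f.bounded
  have hleft : ∀ y, ‖f.left y‖ ≤ ‖f.left‖ := fun y => by
    rw [← ZeroAtInftyContinuousMap.norm_toBCF_eq_norm]
    exact f.left.toBCF.norm_coe_le_norm y
  have hright : ∀ y, ‖f.right y‖ ≤ ‖f.right‖ := fun y => by
    rw [← ZeroAtInftyContinuousMap.norm_toBCF_eq_norm]
    exact f.right.toBCF.norm_coe_le_norm y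
  have key := norm_le_interp_of_mem_verticalClosedStrip₀₁'
    (fun z => truncPow w n (η z) (SumSpace.toAmbientL X Y (f.F z))) (z := (θ : ℂ)) (a := M) (b := M)
    ⟨by simpa using hθ0, by simpa using hθ1⟩ ?_ ?_ ?_ ?_
  · have e : η θ = ((-(θ * t + (1 - θ) * s) : ℝ) : ℂ) := by simp only [hη]; push_cast; ring
    rw [e, ← Real.rpow_add' hM (by simp)] at key
    simpa [SumSpace.toAmbientL_apply] using key
  · have hηd : Differentiable ℂ fun z => truncPow w n (η z) :=
      (differentiable_truncPow w n).comp (by fun_prop)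
    refine ⟨hηd.differentiableOn.clm_apply
      ((SumSpace.toAmbientL X Y).differentiable.comp_differentiableOn f.diffContOnCl.1),
      hηd.continuous.continuousOn.clm_apply
      ((SumSpace.toAmbientL X Y).continuous.comp_continuousOn f.diffContOnCl.2)⟩
  · refine ⟨C * (‖SumSpace.toAmbientL X Y‖ * D), ?_⟩
    rintro _ ⟨z, hz, rfl⟩
    have h0 : 0 ≤ z.re := hz.1
    have h1 : z.re ≤ 1 := hz.2
    refine (hC (η z) ?_ _).trans (mul_le_mul_of_nonneg_left
      (((SumSpace.toAmbientL X Y).le_opNorm _).trans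
        (mul_le_mul_of_nonneg_left (hD z hz) (norm_nonneg _))) hC0)
    rw [hηre, abs_neg, abs_of_nonneg (by have := sub_nonneg.2 h1; positivity)]
    nlinarith
  · intro z hz
    have hz0 : z.re = 0 := hz
    have hzy : z = (z.im : ℂ) * Complex.I := by
      conv_lhs => rw [← Complex.re_add_im z, hz0]
      simp
    rw [SumSpace.toAmbientL_apply, congrArg f.F hzy, f.left_eq, SumSpace.toAmbient_mk, map_zero,
      add_zero, ← hdX]
    refine (norm_truncPow_rpow_apply_le hw n hs (by rw [hηre, hz0]; ring) _).trans ?_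
    exact ((dX.le_opNorm _).trans (mul_le_mul_of_nonneg_left (hleft _) (norm_nonneg _))).trans hMX
  · intro z hz
    have hz0 : z.re = 1 := hz
    have hzy : z = 1 + (z.im : ℂ) * Complex.I := by
      conv_lhs => rw [← Complex.re_add_im z, hz0]
      simp
    rw [SumSpace.toAmbientL_apply, congrArg f.F hzy, f.right_eq, SumSpace.toAmbient_mk, map_zero,
      zero_add, ← hdY]
    refine (norm_truncPow_rpow_apply_le hw n ht (by rw [hηre, hz0]; ring) _).trans ?_
    exact ((dY.le_opNorm _).trans (mul_le_mul_of_nonneg_left (hright _) (norm_nonneg _))).trans hMY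

/-- With `h = F(θ)`, moving a truncated power across the scalar product gives `|⟪h, v⟫| = |⟪w_n^(-r)
h, w_n^r v⟫| ≤ M ‖w_n^r v‖`. Letting `n → ∞` leaves `M ‖w^r v‖`, and the Riesz argument of
`exists_apply_eq_of_inner_le` yields `k` with its norm bound. -/
theorem exists_rpow_apply_eq_of_calderonFun {w : K →L[ℂ] K} (hw : 0 ≤ w) (hw1 : ‖w‖ ≤ 1)
    (hi : Function.Injective w) {X : HilbertSub.{u, v} K} {Y : HilbertSub.{u, w} K} {s t θ : ℝ}
    (hs : 0 ≤ s) (ht : 0 ≤ t) (hθ0 : 0 ≤ θ) (hθ1 : θ ≤ 1)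
    (hX : X.carrier = (w ^ s : K →L[ℂ] K).range) (hY : Y.carrier = (w ^ t : K →L[ℂ] K).range) :
    ∃ C, 0 ≤ C ∧ ∀ f : CalderonFun X Y, ∃ k,
      (w ^ (θ * t + (1 - θ) * s) : K →L[ℂ] K) k = SumSpace.toAmbient X Y (f.F θ) ∧
        ‖k‖ ≤ C * max ‖f.left‖ ‖f.right‖ := by
  obtain ⟨dX, hdX⟩ := exists_lift_of_le_range (rpow_injective_of_nonneg hw hi hs) hX.le
  obtain ⟨dY, hdY⟩ := exists_lift_of_le_range (rpow_injective_of_nonneg hw hi ht) hY.le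
  refine ⟨max ‖dX‖ ‖dY‖, by positivity, fun f => ?_⟩
  set r := θ * t + (1 - θ) * s with hr
  have hr0 : 0 ≤ r := by
    have := sub_nonneg.2 hθ1
    positivity
  set h := SumSpace.toAmbient X Y (f.F θ) with hh
  set M := max ‖dX‖ ‖dY‖ * max ‖f.left‖ ‖f.right‖ with hM
  have hM0 : 0 ≤ M := by positivity
  have hb : ∀ n, ‖truncPow w n ((-r : ℝ) : ℂ) h‖ ≤ M := fun n =>
    norm_truncPow_neg_apply_le hw n hs ht hθ0 hθ1 hdX hdY f
      (mul_le_mul (le_max_left _ _) (le_max_left _ _) (norm_nonneg _) (by positivity))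
      (mul_le_mul (le_max_right _ _) (le_max_right _ _) (norm_nonneg _) (by positivity))
  obtain ⟨k, hk, hkh⟩ := exists_apply_eq_of_inner_le (w ^ r : K →L[ℂ] K) h hM0 fun v => by
    have hsa : ContinuousLinearMap.adjoint (w ^ r : K →L[ℂ] K) = w ^ r :=
      (IsSelfAdjoint.of_nonneg (CFC.rpow_nonneg (a := w) (y := r))).star_eq
    rw [hsa]
    refine ge_of_tendsto ((tendsto_truncPow_rpow hw hw1 hi hr0 v).norm.const_mul M)
      (Filter.Eventually.of_forall fun n => ?_)
    have e : h = truncPow w n r (truncPow w n ((-r : ℝ) : ℂ) h) := by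
      rw [← mul_apply_eq_comp, ← truncPow_add]
      simp [truncPow_zero]
    have hsa' : ContinuousLinearMap.adjoint (truncPow w n r) = truncPow w n r :=
      (isSelfAdjoint_truncPow_ofReal hw n r).star_eq
    conv_lhs => rw [e]
    rw [← ContinuousLinearMap.adjoint_inner_right, hsa']
    exact (norm_inner_le_norm _ _).trans (mul_le_mul_of_nonneg_right (hb n) (norm_nonneg _))
  exact ⟨k, hkh, hk⟩

theorem interpolatesTo_of_carrier_eq {w : K →L[ℂ] K} (hw : 0 ≤ w) (hw1 : ‖w‖ ≤ 1)
    (hi : Function.Injective w) {X : HilbertSub.{u, v} K} {Y Z : HilbertSub.{u, w} K} {s t θ : ℝ}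
    (hs : 0 ≤ s) (ht : 0 ≤ t) (hθ0 : 0 ≤ θ) (hθ1 : θ ≤ 1)
    (hX : X.carrier = (w ^ s : K →L[ℂ] K).range) (hY : Y.carrier = (w ^ t : K →L[ℂ] K).range)
    (hZ : Z.carrier = (w ^ (θ * t + (1 - θ) * s) : K →L[ℂ] K).range) :
    X.InterpolatesTo Y θ Z := by
  have hr0 : 0 ≤ θ * t + (1 - θ) * s := by
    have := sub_nonneg.2 hθ1
    positivity
  obtain ⟨A, hA0, hA⟩ := exists_calderonFun hw hw1 hi hs ht hθ0 hθ1 hX hY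
  obtain ⟨B, hB0, hB⟩ := exists_rpow_apply_eq_of_calderonFun hw hw1 hi hs ht hθ0 hθ1 hX hY
  have hinj := rpow_injective_of_nonneg hw hi hr0
  obtain ⟨e, he⟩ := exists_lift_of_range_le hinj hZ.ge
  obtain ⟨d, hd⟩ := exists_lift_of_le_range hinj hZ.le
  -- The summands `1` keep both constants positive when the operator norms vanish.
  refine ⟨?_, (‖e‖ * B + 1)⁻¹, A * ‖d‖ + 1, by positivity, by positivity, fun z => ⟨?_, ?_⟩⟩
  · ext h
    rw [hZ]
    constructor
    · rintro ⟨f, rfl⟩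
      obtain ⟨k, hk, -⟩ := hB f
      exact ⟨k, hk⟩
    · rintro ⟨k, rfl⟩
      obtain ⟨f, hf, -⟩ := hA k
      exact ⟨f, hf⟩
  · rw [inv_mul_le_iff₀ (by positivity)]
    -- The lower bound needs a nonempty set of competitors, since `sInf ∅` is `0`.
    obtain ⟨f₀, hf₀, -⟩ := hA (d z)
    rw [hd] at hf₀
    rw [interpolationNorm, ← inv_mul_le_iff₀ (by positivity)]
    refine le_csInf ⟨_, f₀, hf₀, rfl⟩ ?_
    rintro _ ⟨f, hf, rfl⟩
    rw [inv_mul_le_iff₀ (by positivity)]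
    obtain ⟨k, hk, hkn⟩ := hB f
    have hz : z = e k := Z.inj (by rw [he, hk, hf])
    have h1 : ‖z‖ ≤ ‖e‖ * (B * max ‖f.left‖ ‖f.right‖) := by
      rw [hz]
      exact (e.le_opNorm k).trans (mul_le_mul_of_nonneg_left hkn (norm_nonneg _))
    have : 0 ≤ max ‖f.left‖ ‖f.right‖ := le_max_of_le_left (norm_nonneg _)
    linarith
  · obtain ⟨f, hf, hfn⟩ := hA (d z)
    rw [hd] at hf
    have h1 : interpolationNorm X Y θ (Z.ι z) ≤ max ‖f.left‖ ‖f.right‖ := by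
      refine csInf_le ⟨0, ?_⟩ ⟨f, hf, rfl⟩
      rintro _ ⟨g, -, rfl⟩
      exact le_max_of_le_left (norm_nonneg _)
    have h2 : A * ‖d z‖ ≤ A * (‖d‖ * ‖z‖) := mul_le_mul_of_nonneg_left (d.le_opNorm z) hA0
    nlinarith [norm_nonneg z]

end HilbertSub

/-- For density, `w^t` lifts to a continuous surjection onto `X t`. It carries the dense
intersection of all ranges to a dense set, which remains in every range because powers of `w`
commute. -/
theorem isInterpolationScale_of_carrier_eq {K : Type u} [NormedAddCommGroup K]
    [InnerProductSpace ℂ K] [CompleteSpace K] {w : K →L[ℂ] K} (hw : 0 ≤ w) (hw1 : ‖w‖ ≤ 1)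
    (hi : Function.Injective w) {X : ℝ≥0 → HilbertSub.{u, v} K}
    (hX : ∀ s : ℝ≥0, (X s).carrier = (w ^ (s : ℝ) : K →L[ℂ] K).range) :
    IsInterpolationScale X where
  embeds s s' h := HilbertSub.embeds_of_carrier_le (by
    rw [hX, hX]
    exact range_rpow_anti s.2 h)
  interpolates s t θ hθ := by
    refine HilbertSub.interpolatesTo_of_carrier_eq hw hw1 hi s.2 t.2 θ.2 hθ (hX s) (hX t) ?_
    rw [hX]
    push_cast [NNReal.coe_sub hθ]
    rfl
  dense t := by
    obtain ⟨e, he⟩ := HilbertSub.exists_lift_of_range_le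
      (rpow_injective_of_nonneg hw hi t.2) (hX t).ge
    have hsurj : Function.Surjective e := fun x => by
      have : (X t).ι x ∈ (w ^ (t : ℝ) : K →L[ℂ] K).range := by
        rw [← hX]; exact ⟨x, rfl⟩
      obtain ⟨k, hk⟩ := this
      exact ⟨k, (X t).inj ((he k).trans hk)⟩
    have h1 := hsurj.denseRange.dense_image e.continuous (dense_iInf_range_rpow hw hi)
    refine h1.mono ?_
    rintro _ ⟨k, hk, rfl⟩ s
    obtain ⟨u, hu⟩ := hk s
    rw [hX, he, ← hu]
    refine ⟨(w ^ (t : ℝ) : K →L[ℂ] K) u, ?_⟩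
    have hc : (w ^ (s : ℝ) : K →L[ℂ] K) * w ^ (t : ℝ) = w ^ (t : ℝ) * w ^ (s : ℝ) := by
      rw [← rpow_add_eq_mul s.coe_nonneg t.coe_nonneg,
        ← rpow_add_eq_mul t.coe_nonneg s.coe_nonneg, add_comm]
    exact congrArg (fun T : K →L[ℂ] K => T u) hc

/-! ### Unbounded operators through their bounded inverses -/

section BoundedInverse

variable {H : Type u} [NormedAddCommGroup H] [InnerProductSpace ℂ H]

/-- The bounded operator `P` is the inverse of the unbounded operator `A`. -/
def IsBoundedInverse (A : H →ₗ.[ℂ] H) (P : H →L[ℂ] H) : Prop :=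
  ∀ x y, (x, y) ∈ A.graph ↔ x = P y

namespace IsBoundedInverse

variable {A : H →ₗ.[ℂ] H} {P : H →L[ℂ] H}

theorem injective (h : IsBoundedInverse A P) : Function.Injective P := by
  rw [injective_iff_map_eq_zero]
  intro y hy
  exact A.graph_fst_eq_zero_snd ((h 0 y).2 hy.symm) rfl

theorem mem_domain_iff (h : IsBoundedInverse A P) (x : H) : x ∈ A.domain ↔ x ∈ Set.range P := by
  rw [LinearPMap.mem_domain_iff]
  simp only [h x, Set.mem_range, eq_comm]

/-- The graph of `A` consists of the pairs `(P v, v)`, so `(x, y)` lies in the adjoint graph exactly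
when `⟪v, x⟫ = ⟪P v, y⟫ = ⟪v, P y⟫` for all `v`. -/
theorem isSelfAdjoint [CompleteSpace H] (h : IsBoundedInverse A P) (hP : IsSelfAdjoint P) :
    IsSelfAdjoint A := by
  have hd : Dense (A.domain : Set H) := by
    have : (A.domain : Set H) = Set.range P := Set.ext h.mem_domain_iff
    rw [this]
    exact denseRange_of_isSelfAdjoint hP h.injective
  have hPa : ContinuousLinearMap.adjoint P = P := hP.star_eq
  rw [LinearPMap.isSelfAdjoint_def]
  apply LinearPMap.eq_of_eq_graph
  rw [LinearPMap.adjoint_graph_eq_graph_adjoint hd]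
  ext ⟨x, y⟩
  rw [Submodule.mem_adjoint_iff, h]
  constructor
  · intro hxy
    refine ext_inner_left ℂ fun v => ?_
    have := hxy (P v) v ((h _ _).2 rfl)
    rw [← ContinuousLinearMap.adjoint_inner_left, hPa]
    exact sub_eq_zero.1 this
  · rintro rfl a b hab
    rw [(h a b).1 hab]
    have := ContinuousLinearMap.adjoint_inner_left P y b
    rw [hPa] at this
    simp only [this, sub_self]

end IsBoundedInverse

theorem norm_le_norm_apply_of_oneLe {A : H →ₗ.[ℂ] H} (h1 : OneLe A) (x : A.domain) :
    ‖(x : H)‖ ≤ ‖A x‖ := by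
  have h2 := h1 x
  have h3 : (inner ℂ (A x) (x : H)).re ≤ ‖A x‖ * ‖(x : H)‖ :=
    (Complex.re_le_norm _).trans (norm_inner_le_norm _ _)
  rcases (norm_nonneg (x : H)).eq_or_lt with h0 | h0
  · rw [← h0]; exact norm_nonneg _
  · nlinarith

variable [CompleteSpace H]

theorem inner_eq_of_mem_graph {A : H →ₗ.[ℂ] H} (hA : IsSelfAdjoint A) {x y a b : H}
    (hxy : (x, y) ∈ A.graph) (hab : (a, b) ∈ A.graph) : inner ℂ b x = inner ℂ a y := by
  have hg : A.graph = A.graph.adjoint := by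
    conv_lhs => rw [← LinearPMap.isSelfAdjoint_def.1 hA]
    exact LinearPMap.adjoint_graph_eq_graph_adjoint hA.dense_domain
  rw [hg, Submodule.mem_adjoint_iff] at hxy
  exact sub_eq_zero.1 (hxy a b hab)

/-- From `A ≥ I` comes `‖x‖ ≤ ‖A x‖`, so the second projection of the closed graph is injective with
closed range. A vector orthogonal to that range lies in the kernel of `A* = A`, hence is zero. -/
theorem exists_isBoundedInverse {A : H →ₗ.[ℂ] H} (hA : IsSelfAdjoint A) (h1 : OneLe A) :
    ∃ P : H →L[ℂ] H, IsBoundedInverse A P ∧ 0 ≤ P ∧ ‖P‖ ≤ 1 := by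
  have hb : ∀ x y, (x, y) ∈ A.graph → ‖x‖ ≤ ‖y‖ := by
    intro x y hxy
    obtain ⟨d, rfl, rfl⟩ := (LinearPMap.mem_graph_iff A).1 hxy
    exact norm_le_norm_apply_of_oneLe h1 d
  have hcl : IsClosed (A.graph : Set (H × H)) := hA.isClosed
  have : CompleteSpace A.graph := hcl.completeSpace_coe
  let f : A.graph →L[ℂ] H := ContinuousLinearMap.snd ℂ H H ∘L A.graph.subtypeL
  have hf : AntilipschitzWith 1 f := by
    refine f.antilipschitz_of_bound fun p => ?_
    obtain ⟨⟨x, y⟩, hp⟩ := p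
    simp only [NNReal.coe_one, one_mul]
    exact max_le (hb x y hp) le_rfl
  have hinj : Function.Injective f := hf.injective
  have hsurj : Function.Surjective f := by
    have hc : IsClosed (f.range : Set H) := hf.isClosed_range f.uniformContinuous
    have hr : f.range = ⊤ := by
      have : CompleteSpace f.range := hc.completeSpace_coe
      rw [← Submodule.orthogonal_eq_bot_iff, Submodule.eq_bot_iff]
      intro y hy
      have hy0 : (y, (0 : H)) ∈ A.graph := by
        rw [← LinearPMap.isSelfAdjoint_def.1 hA,
          LinearPMap.adjoint_graph_eq_graph_adjoint hA.dense_domain, Submodule.mem_adjoint_iff]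
        intro a b hab
        rw [inner_zero_right, sub_zero]
        exact (Submodule.mem_orthogonal _ _).1 hy b ⟨⟨(a, b), hab⟩, rfl⟩
      exact norm_le_zero_iff.1 (by simpa using hb y 0 hy0)
    exact LinearMap.range_eq_top.1 hr
  let e : A.graph ≃ₗ[ℂ] H := LinearEquiv.ofBijective f.toLinearMap ⟨hinj, hsurj⟩
  have he : ∀ y, ((e.symm y : H × H)).2 = y := fun y => e.apply_symm_apply y
  let P : H →L[ℂ] H := LinearMap.mkContinuous
    (LinearMap.fst ℂ H H ∘ₗ A.graph.subtype ∘ₗ e.symm.toLinearMap) 1 (fun y => by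
      rw [one_mul]
      have := hb _ _ (e.symm y).2
      rwa [he] at this)
  have hP : IsBoundedInverse A P := by
    intro x y
    constructor
    · intro hxy
      have : e.symm y = ⟨(x, y), hxy⟩ := by rw [LinearEquiv.symm_apply_eq]; rfl
      change x = ((e.symm y : A.graph) : H × H).1
      rw [this]
    · rintro rfl
      have h2 : ((e.symm y : A.graph) : H × H) = (P y, y) := Prod.ext rfl (he y)
      rw [← h2]
      exact (e.symm y).2
  refine ⟨P, hP, ?_, LinearMap.mkContinuous_norm_le _ zero_le_one _⟩
  rw [ContinuousLinearMap.nonneg_iff_isPositive]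
  refine ⟨fun y z => ?_, fun y => ?_⟩
  · exact (inner_eq_of_mem_graph hA ((hP _ z).2 rfl) ((hP _ y).2 rfl)).symm
  · have hmem := (hP (P y) y).2 rfl
    obtain ⟨d, hd, hAd⟩ := (LinearPMap.mem_graph_iff A).1 hmem
    have h2 := h1 d
    simp only at hd hAd
    rw [hd, hAd] at h2
    rw [ContinuousLinearMap.reApplyInnerSelf_apply, inner_re_symm]
    exact (sq_nonneg _).trans h2

theorem invOneAddSq_eq_cfc {A : H →ₗ.[ℂ] H} (hA : IsSelfAdjoint A) {P : H →L[ℂ] H}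
    (hP : IsBoundedInverse A P) (hP0 : 0 ≤ P) :
    invOneAddSq A hA = cfc (fun x : ℝ => x ^ 2 / (1 + x ^ 2)) P := by
  have hsa : IsSelfAdjoint P := .of_nonneg hP0
  have hne : ∀ x : ℝ, 1 + x ^ 2 ≠ 0 := fun x => by positivity
  have hc : Continuous fun x : ℝ => (1 + x ^ 2)⁻¹ :=
    (by fun_prop : Continuous fun x : ℝ => 1 + x ^ 2).inv₀ hne
  have h1 : cfc (fun x : ℝ => (1 + x ^ 2)⁻¹) P * (1 + P ^ 2) = 1 := by
    have : (1 + P ^ 2 : H →L[ℂ] H) = cfc (fun x : ℝ => 1 + x ^ 2) P := by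
      rw [cfc_add P _ _ (by fun_prop) (by fun_prop), cfc_const_one ℝ P, cfc_pow_id (R := ℝ) P 2]
    rw [this, ← cfc_mul _ _ P hc.continuousOn (by fun_prop), ← cfc_const_one ℝ P]
    exact cfc_congr fun x _ => inv_mul_cancel₀ (hne x)
  have h2 : cfc (fun x : ℝ => x ^ 2 / (1 + x ^ 2)) P =
      P ^ 2 * cfc (fun x : ℝ => (1 + x ^ 2)⁻¹) P := by
    simp only [div_eq_mul_inv]
    rw [cfc_mul _ _ P (by fun_prop) hc.continuousOn, cfc_pow_id (R := ℝ) P 2]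
  ext x
  obtain ⟨y, z, hy, hz, hx⟩ := invOneAddSq_spec A hA x
  rw [hP] at hy hz
  have hR : invOneAddSq A hA x = (P ^ 2) z := by rw [hy, hz, pow_two, mul_apply_eq_comp]
  have hxz : x = (1 + P ^ 2 : H →L[ℂ] H) z := by
    rw [add_apply, one_apply_eq_self, ← hR, add_comm, hx]
  have hzx : cfc (fun x : ℝ => (1 + x ^ 2)⁻¹) P x = z := by
    rw [hxz, ← mul_apply_eq_comp, h1, one_apply_eq_self]
  rw [hR, h2, mul_apply_eq_comp, hzx]

/-- On the spectrum `x² / 2 ≤ x² / (1 + x²) ≤ x²`, because `x ≤ 1`. Raised to the power `s / 2`, the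
symbol of `(I + A²)^(-s/2)` is comparable to `x^s`, with constants `1` and `2^(s/2)`. -/
theorem carrier_sobolevSpace {A : H →ₗ.[ℂ] H} (hA : IsSelfAdjoint A) {P : H →L[ℂ] H}
    (hP : IsBoundedInverse A P) (hP0 : 0 ≤ P) (hP1 : ‖P‖ ≤ 1) (s : ℝ≥0) :
    (sobolevSpace A hA s).carrier = (P ^ (s : ℝ) : H →L[ℂ] H).range := by
  have hsa : IsSelfAdjoint P := .of_nonneg hP0
  have hs : 0 ≤ (s : ℝ) := s.coe_nonneg
  have hs2 : 0 ≤ (s : ℝ) / 2 := by positivity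
  have hc : Continuous fun x : ℝ => x ^ 2 / (1 + x ^ 2) :=
    Continuous.div (by fun_prop) (by fun_prop) fun x => by positivity
  have hcr := Real.continuous_rpow_const hs2
  have hcs := Real.continuous_rpow_const hs
  have e : (invOneAddSq A hA ^ ((s : ℝ) / 2) : H →L[ℂ] H) =
      cfc (fun x : ℝ => (x ^ 2 / (1 + x ^ 2)) ^ ((s : ℝ) / 2)) P := by
    rw [CFC.rpow_eq_cfc_real (invOneAddSq_nonneg A hA), invOneAddSq_eq_cfc hA hP hP0,
      ← cfc_comp' (fun x : ℝ => x ^ ((s : ℝ) / 2)) (fun x : ℝ => x ^ 2 / (1 + x ^ 2)) P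
        hcr.continuousOn hc.continuousOn]
  have hpow : ∀ x : ℝ, 0 ≤ x → x ^ (s : ℝ) = (x ^ 2) ^ ((s : ℝ) / 2) := fun x hx => by
    rw [← Real.rpow_natCast, ← Real.rpow_mul hx]
    congr 1
    push_cast; ring
  change (invOneAddSq A hA ^ ((s : ℝ) / 2) : H →L[ℂ] H).range = _
  rw [e, CFC.rpow_eq_cfc_real hP0]
  apply le_antisymm
  · refine range_cfc_real_le hsa (hcr.comp hc).continuousOn hcs.continuousOn zero_le_one
      fun x hx => ?_
    have hx0 := spectrum_nonneg_of_nonneg hP0 hx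
    rw [one_mul, abs_of_nonneg (by positivity), abs_of_nonneg (by positivity), hpow x hx0]
    exact Real.rpow_le_rpow (by positivity) (div_le_self (by positivity) (by nlinarith)) hs2
  · refine range_cfc_real_le hsa hcs.continuousOn (hcr.comp hc).continuousOn
      (C := 2 ^ ((s : ℝ) / 2)) (by positivity) fun x hx => ?_
    have hx01 := spectrum_mem_Icc hP0 hP1 hx
    have hx0 := hx01.1
    rw [abs_of_nonneg (by positivity), abs_of_nonneg (by positivity), hpow x hx0,
      ← Real.mul_rpow zero_le_two (by positivity)]
    refine Real.rpow_le_rpow (by positivity) ?_ hs2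
    rw [mul_div_assoc', le_div_iff₀ (by positivity)]
    nlinarith [hx01.2, sq_nonneg x, mul_nonneg (sq_nonneg x)
      (sub_nonneg.2 (pow_le_one₀ hx0 hx01.2 (n := 2)))]

end BoundedInverse

/-! ### Bounded operators on completed tensor products -/

section TensorOperators

open UniformSpace.Completion

section Map

variable {H₁ : Type u₁} {H₂ : Type u₂} [NormedAddCommGroup H₁] [InnerProductSpace ℂ H₁]
  [NormedAddCommGroup H₂] [InnerProductSpace ℂ H₂]
  {E₁ : Type v₁} {E₂ : Type v₂} [NormedAddCommGroup E₁] [InnerProductSpace ℂ E₁]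
  [NormedAddCommGroup E₂] [InnerProductSpace ℂ E₂]

/-- The elementary tensor `a ⊗ b` in the completed tensor product. -/
abbrev hTmul (a : H₁) (b : H₂) : HTensor H₁ H₂ := ((a ⊗ₜ[ℂ] b : H₁ ⊗[ℂ] H₂) : HTensor H₁ H₂)

theorem hTensorMap_hTmul (S : E₁ →L[ℂ] H₁) (T : E₂ →L[ℂ] H₂) (a : E₁) (b : E₂) :
    hTensorMap S T (hTmul a b) = hTmul (S a) (T b) := by
  rw [hTensorMap, ContinuousLinearMap.completion_apply_coe]
  rfl

theorem continuous_hTmul_left (b : H₂) : Continuous fun a : H₁ => hTmul a b :=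
  (continuous_coe _).comp ((TensorProduct.continuous_tmul (𝕜 := ℂ) (E := H₁) (F := H₂)).comp
    (f := fun a => (a, b)) (by fun_prop))

theorem continuous_hTmul_right (a : H₁) : Continuous fun b : H₂ => hTmul a b :=
  (continuous_coe _).comp ((TensorProduct.continuous_tmul (𝕜 := ℂ) (E := H₁) (F := H₂)).comp
    (f := fun b => (a, b)) (by fun_prop))

theorem hTensor_ext {F : Type*} [NormedAddCommGroup F] [NormedSpace ℂ F]
    {f g : HTensor E₁ E₂ →L[ℂ] F} (h : ∀ a b, f (hTmul a b) = g (hTmul a b)) : f = g := by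
  ext x
  induction x using UniformSpace.Completion.induction_on with
  | hp => exact isClosed_eq (by fun_prop) (by fun_prop)
  | ih x =>
    induction x using TensorProduct.induction_on with
    | zero => rw [coe_zero, map_zero, map_zero]
    | tmul x y => exact h x y
    | add x y hx hy => rw [coe_add, map_add, map_add, hx, hy]

theorem hTensorMap_comp {G₁ G₂ : Type*} [NormedAddCommGroup G₁] [InnerProductSpace ℂ G₁]
    [NormedAddCommGroup G₂] [InnerProductSpace ℂ G₂] (S : E₁ →L[ℂ] H₁) (T : E₂ →L[ℂ] H₂)
    (S' : G₁ →L[ℂ] E₁) (T' : G₂ →L[ℂ] E₂) :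
    hTensorMap (S ∘L S') (T ∘L T') = hTensorMap S T ∘L hTensorMap S' T' :=
  hTensor_ext fun a b => by
    simp only [hTensorMap_hTmul, ContinuousLinearMap.comp_apply]

theorem hTensorMap_one_one : hTensorMap (1 : H₁ →L[ℂ] H₁) (1 : H₂ →L[ℂ] H₂) = 1 :=
  hTensor_ext fun a b => by rw [hTensorMap_hTmul]; rfl

theorem adjoint_hTensorMap [CompleteSpace H₁] [CompleteSpace H₂] [CompleteSpace E₁]
    [CompleteSpace E₂] (S : E₁ →L[ℂ] H₁) (T : E₂ →L[ℂ] H₂) :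
    ContinuousLinearMap.adjoint (hTensorMap S T) =
      hTensorMap (ContinuousLinearMap.adjoint S) (ContinuousLinearMap.adjoint T) :=
  hTensor_ext fun a b => by
    refine ext_inner_right ℂ fun x => ?_
    rw [hTensorMap_hTmul, ContinuousLinearMap.adjoint_inner_left]
    have : innerSL ℂ (hTmul a b) ∘L hTensorMap S T =
        innerSL ℂ (hTmul (ContinuousLinearMap.adjoint S a) (ContinuousLinearMap.adjoint T b)) :=
      hTensor_ext fun c d => by
        rw [ContinuousLinearMap.comp_apply, hTensorMap_hTmul, innerSL_apply_apply,
          innerSL_apply_apply, inner_coe, inner_coe, TensorProduct.inner_tmul,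
          TensorProduct.inner_tmul, ContinuousLinearMap.adjoint_inner_left,
          ContinuousLinearMap.adjoint_inner_left]
    exact congrArg (fun f => f x) this

theorem dense_of_forall_hTmul_mem {D : Submodule ℂ (HTensor H₁ H₂)}
    (h : ∀ a b, hTmul a b ∈ D.topologicalClosure) : Dense (D : Set (HTensor H₁ H₂)) := by
  rw [Submodule.dense_iff_topologicalClosure_eq_top]
  refine Submodule.eq_top_iff'.2 fun x => ?_
  induction x using UniformSpace.Completion.induction_on with
  | hp => exact D.isClosed_topologicalClosure
  | ih x =>
    induction x using TensorProduct.induction_on with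
    | zero => rw [coe_zero]; exact zero_mem _
    | tmul x y => exact h x y
    | add x y hx hy =>
      rw [coe_add]; exact add_mem hx hy

end Map

variable {H₁ : Type u₁} {H₂ : Type u₂} [NormedAddCommGroup H₁] [InnerProductSpace ℂ H₁]
  [NormedAddCommGroup H₂] [InnerProductSpace ℂ H₂] [CompleteSpace H₁] [CompleteSpace H₂]

/-- The map `f` of bounded operators is a unital `*`-homomorphism. -/
structure IsOperatorRep {H K : Type*} [NormedAddCommGroup H] [InnerProductSpace ℂ H]
    [CompleteSpace H] [NormedAddCommGroup K] [InnerProductSpace ℂ K]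
    (f : (H →L[ℂ] H) → (K →L[ℂ] K)) : Prop where
  map_one : ∀ x, f 1 x = x
  map_mul : ∀ S T x, f (S * T) x = f S (f T x)
  map_add : ∀ S T x, f (S + T) x = f S x + f T x
  map_smul : ∀ (c : ℂ) T x, f (c • T) x = c • f T x
  map_adjoint : ∀ T x y, inner ℂ (f (ContinuousLinearMap.adjoint T) x) y = inner ℂ x (f T y)

theorem isOperatorRep_hTensorMap_left :
    IsOperatorRep fun T : H₁ →L[ℂ] H₁ => hTensorMap T (1 : H₂ →L[ℂ] H₂) where
  map_one x := by rw [hTensorMap_one_one, one_apply_eq_self]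
  map_mul S T x := DFunLike.congr_fun (hTensorMap_comp S (1 : H₂ →L[ℂ] H₂) T 1) x
  map_add S T x := by
    rw [← add_apply]
    refine DFunLike.congr_fun (hTensor_ext fun a b => ?_) x
    rw [add_apply]
    simp only [hTensorMap_hTmul, add_apply, hTmul, TensorProduct.add_tmul, coe_add]
  map_smul c T x := by
    rw [← smul_apply]
    refine DFunLike.congr_fun (hTensor_ext fun a b => ?_) x
    rw [smul_apply]
    simp only [hTensorMap_hTmul, smul_apply, hTmul, ← TensorProduct.smul_tmul', coe_smul]
  map_adjoint T x y := by
    have h := adjoint_hTensorMap T (1 : H₂ →L[ℂ] H₂)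
    rw [← ContinuousLinearMap.star_eq_adjoint (1 : H₂ →L[ℂ] H₂), star_one] at h
    rw [← h, ContinuousLinearMap.adjoint_inner_left]

theorem isOperatorRep_hTensorMap_right :
    IsOperatorRep fun T : H₂ →L[ℂ] H₂ => hTensorMap (1 : H₁ →L[ℂ] H₁) T where
  map_one x := by rw [hTensorMap_one_one, one_apply_eq_self]
  map_mul S T x := DFunLike.congr_fun (hTensorMap_comp (1 : H₁ →L[ℂ] H₁) S 1 T) x
  map_add S T x := by
    rw [← add_apply]
    refine DFunLike.congr_fun (hTensor_ext fun a b => ?_) x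
    rw [add_apply]
    simp only [hTensorMap_hTmul, add_apply, hTmul, TensorProduct.tmul_add, coe_add]
  map_smul c T x := by
    rw [← smul_apply]
    refine DFunLike.congr_fun (hTensor_ext fun a b => ?_) x
    rw [smul_apply]
    simp only [hTensorMap_hTmul, smul_apply, hTmul, TensorProduct.tmul_smul, coe_smul]
  map_adjoint T x y := by
    have h := adjoint_hTensorMap (1 : H₁ →L[ℂ] H₁) T
    rw [← ContinuousLinearMap.star_eq_adjoint (1 : H₁ →L[ℂ] H₁), star_one] at h
    rw [← h, ContinuousLinearMap.adjoint_inner_left]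

/-- The `*`-homomorphism underlying an operator representation. -/
def IsOperatorRep.hom {H K : Type*} [NormedAddCommGroup H] [InnerProductSpace ℂ H]
    [CompleteSpace H] [NormedAddCommGroup K] [InnerProductSpace ℂ K] [CompleteSpace K]
    {f : (H →L[ℂ] H) → (K →L[ℂ] K)} (hf : IsOperatorRep f) :
    (H →L[ℂ] H) →⋆ₐ[ℂ] (K →L[ℂ] K) where
  toFun := f
  map_one' := ContinuousLinearMap.ext hf.map_one
  map_mul' S T := ContinuousLinearMap.ext (hf.map_mul S T)
  map_zero' := ContinuousLinearMap.ext fun x => by simpa using hf.map_smul 0 0 x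
  map_add' S T := ContinuousLinearMap.ext (hf.map_add S T)
  commutes' c := ContinuousLinearMap.ext fun x => by
    rw [Algebra.algebraMap_eq_smul_one, Algebra.algebraMap_eq_smul_one, hf.map_smul, hf.map_one]
    rfl
  map_star' T := by
    rw [ContinuousLinearMap.star_eq_adjoint, ContinuousLinearMap.star_eq_adjoint,
      ContinuousLinearMap.eq_adjoint_iff]
    exact hf.map_adjoint T

/-- Star homomorphisms commute with the continuous functional calculus; this identifies `P^s ⊗ 1`
with `(P ⊗ 1)^s`. -/
theorem map_rpow_of_nonneg {H K : Type*} [NormedAddCommGroup H] [InnerProductSpace ℂ H]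
    [CompleteSpace H] [NormedAddCommGroup K] [InnerProductSpace ℂ K] [CompleteSpace K]
    (φ : (H →L[ℂ] H) →⋆ₐ[ℂ] (K →L[ℂ] K)) {P : H →L[ℂ] H} (hP : 0 ≤ P) {s : ℝ} (hs : 0 ≤ s) :
    φ (P ^ s) = φ P ^ s := by
  have hc := continuous_ofReal_re_rpow hs
  have hsa : IsSelfAdjoint P := .of_nonneg hP
  have hn := hsa.isStarNormal
  have hφ : Continuous φ := map_continuous φ
  rw [rpow_eq_cfc_complex hP, rpow_eq_cfc_complex (map_nonneg φ hP)]
  exact StarAlgHomClass.map_cfc (S := ℂ) φ _ P hc.continuousOn hφ hn (hn.map φ)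

/-- Each embedding factors boundedly through `S` or `T` and conversely; tensoring the factorisations
gives both inclusions. -/
theorem carrier_tensor_eq {X : HilbertSub.{u₁, v₁} H₁} {Y : HilbertSub.{u₂, v₂} H₂}
    {S : H₁ →L[ℂ] H₁} {T : H₂ →L[ℂ] H₂} (hS : Function.Injective S) (hT : Function.Injective T)
    (hX : X.carrier = S.range) (hY : Y.carrier = T.range) :
    (X.tensor Y).carrier = (hTensorMap S T).range := by
  obtain ⟨i₁, hi₁⟩ := HilbertSub.exists_lift_of_range_le hS hX.ge
  obtain ⟨i₂, hi₂⟩ := HilbertSub.exists_lift_of_range_le hT hY.ge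
  obtain ⟨j₁, hj₁⟩ := HilbertSub.exists_lift_of_le_range hS hX.le
  obtain ⟨j₂, hj₂⟩ := HilbertSub.exists_lift_of_le_range hT hY.le
  apply le_antisymm
  · rintro _ ⟨x, rfl⟩
    refine ⟨hTensorMap j₁ j₂ x, ?_⟩
    have h : hTensorMap S T ∘L hTensorMap j₁ j₂ = hTensorMap X.ι Y.ι := by
      rw [← hTensorMap_comp]
      congr 1 <;> ext x <;> simp [hj₁, hj₂]
    exact DFunLike.congr_fun h x
  · rintro _ ⟨x, rfl⟩
    refine ⟨hTensorMap i₁ i₂ x, ?_⟩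
    have h : hTensorMap X.ι Y.ι ∘L hTensorMap i₁ i₂ = hTensorMap S T := by
      rw [← hTensorMap_comp]
      congr 1 <;> ext x <;> simp [hi₁, hi₂]
    exact DFunLike.congr_fun h x

end TensorOperators

/-! ### Joint functional calculus and the harmonic symbol -/

section JointCalculus

variable {K : Type*} [NormedAddCommGroup K] [InnerProductSpace ℂ K] [CompleteSpace K]

/-- The functional calculus of a normal operator for a real-valued function. -/
def realCfc (n : K →L[ℂ] K) (f : ℂ → ℝ) : K →L[ℂ] K := cfc (fun z => ((f z : ℝ) : ℂ)) n

section

variable {n : K →L[ℂ] K} {f g : ℂ → ℝ}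

theorem continuousOn_ofReal_comp {S : Set ℂ} (hf : ContinuousOn f S) :
    ContinuousOn (fun z => ((f z : ℝ) : ℂ)) S := Complex.continuous_ofReal.comp_continuousOn hf

theorem realCfc_mul (hf : ContinuousOn f (spectrum ℂ n)) (hg : ContinuousOn g (spectrum ℂ n)) :
    realCfc n (fun z => f z * g z) = realCfc n f * realCfc n g := by
  simp only [realCfc, Complex.ofReal_mul]
  exact cfc_mul _ _ n (continuousOn_ofReal_comp hf) (continuousOn_ofReal_comp hg)

theorem realCfc_add (hf : ContinuousOn f (spectrum ℂ n)) (hg : ContinuousOn g (spectrum ℂ n)) :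
    realCfc n (fun z => f z + g z) = realCfc n f + realCfc n g := by
  simp only [realCfc, Complex.ofReal_add]
  exact cfc_add n _ _ (continuousOn_ofReal_comp hf) (continuousOn_ofReal_comp hg)

theorem realCfc_congr (h : ∀ z ∈ spectrum ℂ n, f z = g z) : realCfc n f = realCfc n g :=
  cfc_congr fun z hz => by simp only [h z hz]

theorem realCfc_one [hn : IsStarNormal n] : realCfc n (fun _ => 1) = 1 := by
  simp only [realCfc, Complex.ofReal_one]
  exact cfc_const_one ℂ n

theorem isSelfAdjoint_realCfc : IsSelfAdjoint (realCfc n f) := by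
  rw [IsSelfAdjoint, realCfc, ← cfc_star]
  simp only [Complex.star_def, Complex.conj_ofReal]

theorem realCfc_nonneg (h : ∀ z ∈ spectrum ℂ n, 0 ≤ f z) : 0 ≤ realCfc n f :=
  cfc_nonneg fun z hz => by exact_mod_cast h z hz

theorem norm_realCfc_apply_le [IsStarNormal n] (hf : ContinuousOn f (spectrum ℂ n))
    (hg : ContinuousOn g (spectrum ℂ n)) {C : ℝ} (hC : 0 ≤ C)
    (h : ∀ z ∈ spectrum ℂ n, |f z| ≤ C * |g z|) (v : K) :
    ‖realCfc n f v‖ ≤ C * ‖realCfc n g v‖ :=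
  norm_cfc_apply_le (continuousOn_ofReal_comp hf) (continuousOn_ofReal_comp hg) hC
    (by simpa using h) v

theorem range_realCfc_le [IsStarNormal n] (hf : ContinuousOn f (spectrum ℂ n))
    (hg : ContinuousOn g (spectrum ℂ n)) {C : ℝ} (hC : 0 ≤ C)
    (h : ∀ z ∈ spectrum ℂ n, |f z| ≤ C * |g z|) : (realCfc n f).range ≤ (realCfc n g).range :=
  range_cfc_le (continuousOn_ofReal_comp hf) (continuousOn_ofReal_comp hg) hC (by simpa using h)

theorem realCfc_rpow [IsStarNormal n] (hf : ContinuousOn f (spectrum ℂ n))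
    (h0 : ∀ z ∈ spectrum ℂ n, 0 ≤ f z) {s : ℝ} (hs : 0 ≤ s) :
    realCfc n f ^ s = realCfc n fun z => f z ^ s := by
  have hc := continuous_ofReal_re_rpow hs
  rw [rpow_eq_cfc_complex (realCfc_nonneg h0), realCfc, realCfc,
    ← cfc_comp' (fun z : ℂ => ((z.re ^ s : ℝ) : ℂ)) _ n hc.continuousOn
      (continuousOn_ofReal_comp hf)]
  simp only [Complex.ofReal_re]

end

/-- The product of the coordinates divided by their sum. -/
def harmonicSymbol (z : ℂ) : ℝ := z.re * z.im / (z.re + z.im)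

theorem harmonicSymbol_nonneg {z : ℂ} (h1 : 0 ≤ z.re) (h2 : 0 ≤ z.im) : 0 ≤ harmonicSymbol z := by
  unfold harmonicSymbol; positivity

theorem harmonicSymbol_le_re {z : ℂ} (h1 : 0 ≤ z.re) (h2 : 0 ≤ z.im) :
    harmonicSymbol z ≤ z.re := by
  unfold harmonicSymbol
  rcases (add_nonneg h1 h2).eq_or_lt with h | h
  · rw [← h, div_zero]; exact h1
  · rw [div_le_iff₀ h]; nlinarith

theorem harmonicSymbol_le_im {z : ℂ} (h1 : 0 ≤ z.re) (h2 : 0 ≤ z.im) :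
    harmonicSymbol z ≤ z.im := by
  unfold harmonicSymbol
  rcases (add_nonneg h1 h2).eq_or_lt with h | h
  · rw [← h, div_zero]; exact h2
  · rw [div_le_iff₀ h]; nlinarith

theorem add_mul_harmonicSymbol {z : ℂ} (h1 : 0 ≤ z.re) (h2 : 0 ≤ z.im) :
    (z.re + z.im) * harmonicSymbol z = z.re * z.im := by
  unfold harmonicSymbol
  rcases (add_nonneg h1 h2).eq_or_lt with h | h
  · have : z.re = 0 := by linarith
    rw [← h, this]; simp
  · field_simp

/-- The larger coordinate is at least half the sum. With the upper bounds by `re` and `im`, the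
symbol is comparable to the minimum of the coordinates. -/
theorem min_le_two_mul_harmonicSymbol {z : ℂ} (h1 : 0 ≤ z.re) (h2 : 0 ≤ z.im) :
    min z.re z.im ≤ 2 * harmonicSymbol z := by
  unfold harmonicSymbol
  rcases (add_nonneg h1 h2).eq_or_lt with h | h
  · rw [← h, div_zero, mul_zero]
    exact (min_le_left _ _).trans (by linarith)
  · rw [mul_div_assoc', le_div_iff₀ h]
    rcases le_total z.re z.im with hle | hle
    · rw [min_eq_left hle]; nlinarith
    · rw [min_eq_right hle]; nlinarith

/-- Only the origin needs care: there the quotient is `0 / 0 = 0`, which is also its limit because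
the symbol lies between `0` and `re` on the quadrant. -/
theorem continuousOn_harmonicSymbol :
    ContinuousOn harmonicSymbol {z : ℂ | 0 ≤ z.re ∧ 0 ≤ z.im} := by
  rintro z ⟨h1, h2⟩
  rcases (add_nonneg h1 h2).eq_or_lt with h | h
  · have hr : z.re = 0 := by linarith
    have h0 : harmonicSymbol z = 0 := by simp [harmonicSymbol, hr]
    rw [ContinuousWithinAt, h0]
    have hre : Filter.Tendsto Complex.re (nhdsWithin z {z : ℂ | 0 ≤ z.re ∧ 0 ≤ z.im}) (nhds 0) := by
      rw [← hr]
      exact Complex.continuous_re.continuousWithinAt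
    refine squeeze_zero' ?_ ?_ hre
    · filter_upwards [self_mem_nhdsWithin] with w hw using harmonicSymbol_nonneg hw.1 hw.2
    · filter_upwards [self_mem_nhdsWithin] with w hw using harmonicSymbol_le_re hw.1 hw.2
  · refine ContinuousAt.continuousWithinAt ?_
    exact ContinuousAt.div (by fun_prop) (by fun_prop) h.ne'

theorem mul_div_le_harmonicSymbol {s ε : ℝ} (hs : 0 ≤ s) (hε : 0 < ε) {z : ℂ} (h1 : 0 ≤ z.re)
    (h2 : 0 ≤ z.im) :
    z.re ^ s * z.im ^ s / (z.re ^ s + z.im ^ s + ε) ≤ 2 ^ s * harmonicSymbol z ^ s := by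
  have hx := Real.rpow_nonneg h1 s
  have hy := Real.rpow_nonneg h2 s
  rw [← Real.mul_rpow zero_le_two (harmonicSymbol_nonneg h1 h2)]
  refine le_trans ?_ (Real.rpow_le_rpow (le_min h1 h2) (min_le_two_mul_harmonicSymbol h1 h2) hs)
  rw [div_le_iff₀ (by positivity)]
  rcases le_total z.re z.im with hle | hle
  · rw [min_eq_left hle]
    exact mul_le_mul_of_nonneg_left (by linarith) hx
  · rw [min_eq_right hle, mul_comm]
    exact mul_le_mul_of_nonneg_left (by linarith) hy

/-! ### Commuting positive contractions and the inverse of a sum -/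

section Pair

variable {p q : K →L[ℂ] K}

theorem isStarNormal_add_I_smul (hp : IsSelfAdjoint p) (hq : IsSelfAdjoint q) (h : Commute p q) :
    IsStarNormal (p + Complex.I • q) := by
  refine ⟨?_⟩
  rw [star_add, star_smul, hp.star_eq, hq.star_eq]
  exact ((Commute.refl p).add_left (h.symm.smul_left _)).add_right
    ((h.smul_right _).add_left ((Commute.refl q).smul_left _ |>.smul_right _))

theorem realPart_add_I_smul (hp : IsSelfAdjoint p) (hq : IsSelfAdjoint q) :
    (realPart (p + Complex.I • q) : K →L[ℂ] K) = p := by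
  rw [map_add, realPart_I_smul, hq.imaginaryPart, neg_zero, add_zero, hp.coe_realPart]

theorem imaginaryPart_add_I_smul (hp : IsSelfAdjoint p) (hq : IsSelfAdjoint q) :
    (imaginaryPart (p + Complex.I • q) : K →L[ℂ] K) = q := by
  rw [map_add, imaginaryPart_I_smul, hp.imaginaryPart, zero_add, hq.coe_realPart]

/-- The spectra of `p` and `q` are the coordinate projections of the spectrum of `p + i q`. -/
theorem re_im_mem_Icc (hp : 0 ≤ p) (hq : 0 ≤ q) (hp1 : ‖p‖ ≤ 1) (hq1 : ‖q‖ ≤ 1) (h : Commute p q)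
    {z : ℂ} (hz : z ∈ spectrum ℂ (p + Complex.I • q)) :
    z.re ∈ Set.Icc (0 : ℝ) 1 ∧ z.im ∈ Set.Icc (0 : ℝ) 1 := by
  have hps : IsSelfAdjoint p := .of_nonneg hp
  have hqs : IsSelfAdjoint q := .of_nonneg hq
  have hn := isStarNormal_add_I_smul hps hqs h
  constructor
  · apply spectrum_mem_Icc hp hp1
    rw [← realPart_add_I_smul hps hqs, spectrum_realPart' _ hn]
    exact ⟨z, hz, rfl⟩
  · apply spectrum_mem_Icc hq hq1
    rw [← imaginaryPart_add_I_smul hps hqs, spectrum_imaginaryPart' _ hn]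
    exact ⟨z, hz, rfl⟩

theorem rpow_eq_realCfc_re (hp : 0 ≤ p) (hq : 0 ≤ q) (h : Commute p q) {s : ℝ} (hs : 0 ≤ s) :
    p ^ s = realCfc (p + Complex.I • q) fun z => z.re ^ s := by
  have hps : IsSelfAdjoint p := .of_nonneg hp
  have hqs : IsSelfAdjoint q := .of_nonneg hq
  have hn := isStarNormal_add_I_smul hps hqs h
  have := cfc_comp_re (fun x => x ^ s) (p + Complex.I • q)
    (Real.continuous_rpow_const hs).continuousOn hn
  rw [realPart_add_I_smul hps hqs, ← CFC.rpow_eq_cfc_real hp] at this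
  exact this.symm

theorem rpow_eq_realCfc_im (hp : 0 ≤ p) (hq : 0 ≤ q) (h : Commute p q) {s : ℝ} (hs : 0 ≤ s) :
    q ^ s = realCfc (p + Complex.I • q) fun z => z.im ^ s := by
  have hps : IsSelfAdjoint p := .of_nonneg hp
  have hqs : IsSelfAdjoint q := .of_nonneg hq
  have hn := isStarNormal_add_I_smul hps hqs h
  have := cfc_comp_im (fun x => x ^ s) (p + Complex.I • q)
    (Real.continuous_rpow_const hs).continuousOn hn
  rw [imaginaryPart_add_I_smul hps hqs, ← CFC.rpow_eq_cfc_real hq] at this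
  exact this.symm

/-- The operator `p q (p + q)⁻¹ = (p⁻¹ + q⁻¹)⁻¹` for commuting positive operators. -/
def harmonicOp (p q : K →L[ℂ] K) : K →L[ℂ] K := realCfc (p + Complex.I • q) harmonicSymbol

/-- Two commuting injective positive contractions. -/
structure IsCommutingPair (p q : K →L[ℂ] K) : Prop where
  left_nonneg : 0 ≤ p
  right_nonneg : 0 ≤ q
  left_norm_le : ‖p‖ ≤ 1
  right_norm_le : ‖q‖ ≤ 1
  left_injective : Function.Injective p
  right_injective : Function.Injective q
  commute : Commute p q

namespace IsCommutingPair

theorem isStarNormal (h : IsCommutingPair p q) : IsStarNormal (p + Complex.I • q) :=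
  isStarNormal_add_I_smul (.of_nonneg h.left_nonneg) (.of_nonneg h.right_nonneg) h.commute

theorem mem_Icc (h : IsCommutingPair p q) {z : ℂ} (hz : z ∈ spectrum ℂ (p + Complex.I • q)) :
    z.re ∈ Set.Icc (0 : ℝ) 1 ∧ z.im ∈ Set.Icc (0 : ℝ) 1 :=
  re_im_mem_Icc h.left_nonneg h.right_nonneg h.left_norm_le h.right_norm_le h.commute hz

theorem continuousOn_symbol (h : IsCommutingPair p q) :
    ContinuousOn harmonicSymbol (spectrum ℂ (p + Complex.I • q)) :=
  continuousOn_harmonicSymbol.mono fun _ hz => ⟨(h.mem_Icc hz).1.1, (h.mem_Icc hz).2.1⟩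

theorem left_eq (h : IsCommutingPair p q) : p = realCfc (p + Complex.I • q) fun z => z.re := by
  have := rpow_eq_realCfc_re h.left_nonneg h.right_nonneg h.commute zero_le_one
  rw [CFC.rpow_one p h.left_nonneg] at this
  simpa using this

theorem right_eq (h : IsCommutingPair p q) : q = realCfc (p + Complex.I • q) fun z => z.im := by
  have := rpow_eq_realCfc_im h.left_nonneg h.right_nonneg h.commute zero_le_one
  rw [CFC.rpow_one q h.right_nonneg] at this
  simpa using this

theorem harmonicOp_nonneg (h : IsCommutingPair p q) : 0 ≤ harmonicOp p q :=
  realCfc_nonneg fun _ hz => harmonicSymbol_nonneg (h.mem_Icc hz).1.1 (h.mem_Icc hz).2.1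

/-- An identity of symbols that holds at the origin too, so it replaces division by `p + q`, which
need not be boundedly invertible. -/
theorem add_mul_harmonicOp (h : IsCommutingPair p q) : (p + q) * harmonicOp p q = p * q := by
  have e1 : p + q = realCfc (p + Complex.I • q) fun z => z.re + z.im := by
    rw [realCfc_add Complex.continuous_re.continuousOn Complex.continuous_im.continuousOn,
      ← h.left_eq, ← h.right_eq]
  have e2 : p * q = realCfc (p + Complex.I • q) fun z => z.re * z.im := by
    rw [realCfc_mul Complex.continuous_re.continuousOn Complex.continuous_im.continuousOn,
      ← h.left_eq, ← h.right_eq]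
  rw [e2, e1, harmonicOp, ← realCfc_mul (by fun_prop) h.continuousOn_symbol]
  exact realCfc_congr fun z hz => add_mul_harmonicSymbol (h.mem_Icc hz).1.1 (h.mem_Icc hz).2.1

theorem harmonicOp_injective (h : IsCommutingPair p q) : Function.Injective (harmonicOp p q) := by
  intro x y hxy
  refine (h.left_injective.comp h.right_injective) (?_ : (p * q) _ = (p * q) _)
  rw [← h.add_mul_harmonicOp, mul_apply_eq_comp, mul_apply_eq_comp, hxy]

theorem norm_harmonicOp_le (h : IsCommutingPair p q) : ‖harmonicOp p q‖ ≤ 1 := by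
  have hn := h.isStarNormal
  refine ContinuousLinearMap.opNorm_le_bound _ zero_le_one fun v => ?_
  have h1 := norm_realCfc_apply_le (n := p + Complex.I • q) h.continuousOn_symbol
    (g := fun _ => 1) (by fun_prop) zero_le_one (fun z hz => by
      have hz := h.mem_Icc hz
      rw [abs_of_nonneg (harmonicSymbol_nonneg hz.1.1 hz.2.1), abs_one, one_mul]
      exact (harmonicSymbol_le_re hz.1.1 hz.2.1).trans hz.1.2) v
  rwa [realCfc_one, one_apply_eq_self] at h1

theorem harmonicOp_rpow (h : IsCommutingPair p q) {s : ℝ} (hs : 0 ≤ s) :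
    harmonicOp p q ^ s = realCfc (p + Complex.I • q) fun z => harmonicSymbol z ^ s :=
  have := h.isStarNormal
  realCfc_rpow h.continuousOn_symbol
    (fun _ hz => harmonicSymbol_nonneg (h.mem_Icc hz).1.1 (h.mem_Icc hz).2.1) hs

theorem continuousOn_symbol_rpow (h : IsCommutingPair p q) {s : ℝ} (hs : 0 ≤ s) :
    ContinuousOn (fun z => harmonicSymbol z ^ s) (spectrum ℂ (p + Complex.I • q)) :=
  (Real.continuous_rpow_const hs).comp_continuousOn h.continuousOn_symbol

/-- The harmonic symbol is at most either coordinate, so its power `s + t` is at most `x^s y^t`. -/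
theorem range_harmonicOp_rpow_le (h : IsCommutingPair p q) {s t : ℝ} (hs : 0 ≤ s) (ht : 0 ≤ t) :
    (harmonicOp p q ^ (s + t) : K →L[ℂ] K).range ≤ (p ^ s * q ^ t : K →L[ℂ] K).range := by
  have hn := h.isStarNormal
  have hre : Continuous fun z : ℂ => z.re ^ s :=
    (Real.continuous_rpow_const hs).comp Complex.continuous_re
  have him : Continuous fun z : ℂ => z.im ^ t :=
    (Real.continuous_rpow_const ht).comp Complex.continuous_im
  rw [h.harmonicOp_rpow (add_nonneg hs ht),
    rpow_eq_realCfc_re h.left_nonneg h.right_nonneg h.commute hs,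
    rpow_eq_realCfc_im h.left_nonneg h.right_nonneg h.commute ht,
    ← realCfc_mul hre.continuousOn him.continuousOn]
  refine range_realCfc_le (h.continuousOn_symbol_rpow (add_nonneg hs ht))
    (hre.mul him).continuousOn zero_le_one fun z hz => ?_
  obtain ⟨⟨h1, -⟩, ⟨h2, -⟩⟩ := h.mem_Icc hz
  have h0 := harmonicSymbol_nonneg h1 h2
  rw [one_mul, abs_of_nonneg (by positivity), abs_of_nonneg (by positivity),
    Real.rpow_add_of_nonneg h0 hs ht]
  exact mul_le_mul (Real.rpow_le_rpow h0 (harmonicSymbol_le_re h1 h2) hs)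
    (Real.rpow_le_rpow h0 (harmonicSymbol_le_im h1 h2) ht) (by positivity) (by positivity)

/-- Write `a = x^s`, `b = y^s` for the symbols of `p^s` and `q^s`, and split `1 = a/D + b/D + ε/D`
with `D = a + b + ε`. Applied to the common vector, the first term acts on it as an image under
`q^s` and the second as an image under `p^s`. Both then produce `ab/D`, which is at most `2^s m^s`
for the harmonic symbol `m`. The term `ε` is needed because `a + b` may vanish on the spectrum; it
leaves a remainder of norm at most `ε ‖x‖`. -/
theorem norm_inner_le_of_rpow_apply_eq (h : IsCommutingPair p q) {s ε : ℝ} (hs : 0 ≤ s)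
    (hε : 0 < ε) {x y : K}
    (hxy : (p ^ s : K →L[ℂ] K) x = (q ^ s : K →L[ℂ] K) y) (v : K) :
    ‖inner ℂ ((p ^ s : K →L[ℂ] K) x) v‖ ≤
      2 ^ s * (‖x‖ + ‖y‖) * ‖(harmonicOp p q ^ s : K →L[ℂ] K) v‖ + ε * (‖x‖ * ‖v‖) := by
  have hn := h.isStarNormal
  have hre : Continuous fun z : ℂ => z.re ^ s :=
    (Real.continuous_rpow_const hs).comp Complex.continuous_re
  have him : Continuous fun z : ℂ => z.im ^ s :=
    (Real.continuous_rpow_const hs).comp Complex.continuous_im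
  set n := p + Complex.I • q with hnd
  set D : ℂ → ℝ := fun z => z.re ^ s + z.im ^ s + ε with hD
  have hD0 : ∀ z ∈ spectrum ℂ n, 0 < D z := fun z hz => by
    have := Real.rpow_nonneg (h.mem_Icc hz).1.1 s
    have := Real.rpow_nonneg (h.mem_Icc hz).2.1 s
    positivity
  have hDc : ContinuousOn D (spectrum ℂ n) := by fun_prop
  have hα : ContinuousOn (fun z => z.re ^ s / D z) (spectrum ℂ n) :=
    hre.continuousOn.div hDc fun z hz => (hD0 z hz).ne'
  have hβ : ContinuousOn (fun z => z.im ^ s / D z) (spectrum ℂ n) :=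
    him.continuousOn.div hDc fun z hz => (hD0 z hz).ne'
  have hγ : ContinuousOn (fun z => ε / D z) (spectrum ℂ n) :=
    continuousOn_const.div hDc fun z hz => (hD0 z hz).ne'
  have hG : ContinuousOn (fun z => z.re ^ s * z.im ^ s / D z) (spectrum ℂ n) :=
    (hre.mul him).continuousOn.div hDc fun z hz => (hD0 z hz).ne'
  have hE : ContinuousOn (fun z => ε * z.re ^ s / D z) (spectrum ℂ n) :=
    (continuous_const.mul hre).continuousOn.div hDc fun z hz => (hD0 z hz).ne'
  have hps := rpow_eq_realCfc_re h.left_nonneg h.right_nonneg h.commute hs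
  have hqs := rpow_eq_realCfc_im h.left_nonneg h.right_nonneg h.commute hs
  rw [← hnd] at hps hqs
  set G := realCfc n fun z => z.re ^ s * z.im ^ s / D z with hGd
  set E := realCfc n fun z => ε * z.re ^ s / D z with hEd
  have e1 : realCfc n (fun z => z.re ^ s / D z) * q ^ s = G := by
    rw [hqs, ← realCfc_mul hα him.continuousOn]
    exact realCfc_congr fun z _ => by ring
  have e2 : realCfc n (fun z => z.im ^ s / D z) * p ^ s = G := by
    rw [hps, ← realCfc_mul hβ hre.continuousOn]
    exact realCfc_congr fun z _ => by ring
  have e3 : realCfc n (fun z => ε / D z) * p ^ s = E := by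
    rw [hps, ← realCfc_mul hγ hre.continuousOn]
    exact realCfc_congr fun z _ => by ring
  have e4 : realCfc n (fun z => z.re ^ s / D z) + realCfc n (fun z => z.im ^ s / D z) +
      realCfc n (fun z => ε / D z) = 1 := by
    rw [← realCfc_add hα hβ,
      ← realCfc_add (f := fun z => z.re ^ s / D z + z.im ^ s / D z) (hα.add hβ) hγ,
      ← realCfc_one (n := n)]
    refine realCfc_congr fun z hz => ?_
    rw [← add_div, ← add_div, div_self (hD0 z hz).ne']
  have e5 : (p ^ s : K →L[ℂ] K) x = G y + G x + E x := by
    conv_lhs => rw [← one_apply_eq_self (F := K →L[ℂ] K) ((p ^ s : K →L[ℂ] K) x), ← e4]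
    rw [add_apply, add_apply]
    -- Only the first summand is rewritten as an image under `q^s`; the other two stay images under
    -- `p^s`.
    conv_lhs => enter [1, 1]; rw [hxy]
    simp only [← mul_apply_eq_comp, e1, e2, e3]
  have hGv : ‖G v‖ ≤ 2 ^ s * ‖(harmonicOp p q ^ s : K →L[ℂ] K) v‖ := by
    rw [h.harmonicOp_rpow hs]
    refine norm_realCfc_apply_le hG (h.continuousOn_symbol_rpow hs) (by positivity)
      (fun z hz => ?_) v
    obtain ⟨⟨h1, -⟩, ⟨h2, -⟩⟩ := h.mem_Icc hz
    have h0 := harmonicSymbol_nonneg h1 h2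
    have hDz := hD0 z hz
    rw [abs_of_nonneg (by positivity), abs_of_nonneg (by positivity)]
    exact mul_div_le_harmonicSymbol hs hε h1 h2
  have hEx : ‖E x‖ ≤ ε * ‖x‖ := by
    have := norm_realCfc_apply_le (g := fun _ => 1) hE (by fun_prop) hε.le (fun z hz => by
      obtain ⟨⟨h1, -⟩, ⟨h2, -⟩⟩ := h.mem_Icc hz
      have hDz := hD0 z hz
      rw [abs_of_nonneg (by positivity), abs_one, mul_one, div_le_iff₀ hDz]
      have := Real.rpow_nonneg h2 s
      exact mul_le_mul_of_nonneg_left (by simp only [hD]; linarith) hε.le) x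
    rwa [realCfc_one, one_apply_eq_self] at this
  have hGa : ∀ u, inner ℂ (G u) v = inner ℂ u (G v) := fun u => by
    have hsa : ContinuousLinearMap.adjoint G = G := isSelfAdjoint_realCfc.star_eq
    conv_rhs => rw [← ContinuousLinearMap.adjoint_inner_left, hsa]
  rw [e5, inner_add_left, inner_add_left, hGa, hGa]
  have b1 := norm_add₃_le (a := inner ℂ y (G v)) (b := inner ℂ x (G v)) (c := inner ℂ (E x) v)
  have b2 := (norm_inner_le_norm (𝕜 := ℂ) y (G v)).trans
    (mul_le_mul_of_nonneg_left hGv (norm_nonneg y))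
  have b3 := (norm_inner_le_norm (𝕜 := ℂ) x (G v)).trans
    (mul_le_mul_of_nonneg_left hGv (norm_nonneg x))
  have b4 := (norm_inner_le_norm (𝕜 := ℂ) (E x) v).trans
    (mul_le_mul_of_nonneg_right hEx (norm_nonneg v))
  linarith

/-- Letting `ε → 0` in the previous estimate gives the hypothesis of `exists_apply_eq_of_inner_le`.
The reverse inclusion is `range_harmonicOp_rpow_le` with one exponent zero. -/
theorem range_rpow_inf_range_rpow (h : IsCommutingPair p q) {s : ℝ} (hs : 0 ≤ s) :
    (p ^ s : K →L[ℂ] K).range ⊓ (q ^ s : K →L[ℂ] K).range =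
      (harmonicOp p q ^ s : K →L[ℂ] K).range := by
  apply le_antisymm
  · rintro _ ⟨⟨x, rfl⟩, ⟨y, hy⟩⟩
    have hxy : (p ^ s : K →L[ℂ] K) x = (q ^ s : K →L[ℂ] K) y := hy.symm
    obtain ⟨k, -, hk⟩ := exists_apply_eq_of_inner_le (harmonicOp p q ^ s : K →L[ℂ] K)
      ((p ^ s : K →L[ℂ] K) x) (M := 2 ^ s * (‖x‖ + ‖y‖)) (by positivity) fun v => by
        have hsa : ContinuousLinearMap.adjoint (harmonicOp p q ^ s : K →L[ℂ] K) =
            harmonicOp p q ^ s :=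
          (IsSelfAdjoint.of_nonneg (CFC.rpow_nonneg (a := harmonicOp p q) (y := s))).star_eq
        rw [hsa]
        refine le_of_forall_pos_le_add fun δ hδ => ?_
        refine (h.norm_inner_le_of_rpow_apply_eq hs
          (ε := δ / (‖x‖ * ‖v‖ + 1)) (by positivity) hxy v).trans (add_le_add_right ?_ _)
        rw [div_mul_eq_mul_div, div_le_iff₀ (by positivity)]
        nlinarith
    exact ⟨k, hk⟩
  · refine le_inf ?_ ?_
    · have := h.range_harmonicOp_rpow_le hs le_rfl
      rwa [add_zero, CFC.rpow_zero q h.right_nonneg, mul_one] at this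
    · have := h.range_harmonicOp_rpow_le le_rfl hs
      rwa [zero_add, CFC.rpow_zero p h.left_nonneg, one_mul] at this

/-- If `x = p a = q b`, then `(p + q) x = pq(a + b) = (p + q) m (a + b)` with `m = harmonicOp p q`,
and `p + q` is injective, so `x = m (a + b)`. Hence the sum on the intersection of the domains
already has an everywhere defined bounded inverse, and no closure is needed. -/
theorem isBoundedInverse_add (h : IsCommutingPair p q) {A B : K →ₗ.[ℂ] K}
    (hA : IsBoundedInverse A p)
    (hB : IsBoundedInverse B q) : IsBoundedInverse (A + B) (harmonicOp p q) := by
  have key : ∀ {x a b : K}, x = p a → x = q b → harmonicOp p q (a + b) = x := by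
    intro x a b ha hb
    have h1 : (p * q) (a + b) = (p + q) x := by
      have hc : p * q = q * p := h.commute
      conv_lhs => rw [map_add]
      rw [add_apply]
      conv_lhs => enter [1]; rw [hc]
      rw [mul_apply_eq_comp, mul_apply_eq_comp, ← ha, ← hb, add_comm]
    have hinj : Function.Injective (p + q) := by
      have hc : (p + q) * harmonicOp p q = harmonicOp p q * (p + q) := by
        have hp1 : Commute p (harmonicOp p q) := by
          conv_lhs => rw [h.left_eq]
          exact cfc_commute_cfc _ _ _
        have hq1 : Commute q (harmonicOp p q) := by
          conv_lhs => rw [h.right_eq]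
          exact cfc_commute_cfc _ _ _
        exact hp1.add_left hq1
      intro u v huv
      refine (h.left_injective.comp h.right_injective) (?_ : (p * q) _ = (p * q) _)
      rw [← h.add_mul_harmonicOp, hc, mul_apply_eq_comp, mul_apply_eq_comp, huv]
    apply hinj
    rw [← h1, ← h.add_mul_harmonicOp, mul_apply_eq_comp]
  have graph_iff : ∀ x y, (x, y) ∈ (A + B).graph ↔
      ∃ a b, (x, a) ∈ A.graph ∧ (x, b) ∈ B.graph ∧ a + b = y := by
    intro x y
    constructor
    · intro hxy
      obtain ⟨d, hd, hy⟩ := (LinearPMap.mem_graph_iff _).1 hxy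
      obtain ⟨d, hdA, hdB⟩ := d
      simp only at hd hy
      subst hd
      exact ⟨A ⟨d, hdA⟩, B ⟨d, hdB⟩, A.mem_graph ⟨d, hdA⟩, B.mem_graph ⟨d, hdB⟩, hy⟩
    · rintro ⟨a, b, ha, hb, rfl⟩
      have hdA := LinearPMap.mem_domain_of_mem_graph ha
      have hdB := LinearPMap.mem_domain_of_mem_graph hb
      have ha' := A.mem_graph_snd_inj (A.mem_graph ⟨x, hdA⟩) ha rfl
      have hb' := B.mem_graph_snd_inj (B.mem_graph ⟨x, hdB⟩) hb rfl
      rw [← ha', ← hb']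
      exact (A + B).mem_graph ⟨x, hdA, hdB⟩
  intro x y
  rw [graph_iff]
  constructor
  · rintro ⟨a, b, ha, hb, rfl⟩
    exact (key ((hA x a).1 ha) ((hB x b).1 hb)).symm
  · intro hxy
    -- The case `s = 1` of the intersection formula puts every `m y` into both domains.
    have hx : x ∈ (harmonicOp p q ^ (1 : ℝ) : K →L[ℂ] K).range := by
      rw [CFC.rpow_one _ h.harmonicOp_nonneg]
      exact ⟨y, hxy.symm⟩
    rw [← h.range_rpow_inf_range_rpow zero_le_one, CFC.rpow_one p h.left_nonneg,
      CFC.rpow_one q h.right_nonneg] at hx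
    obtain ⟨⟨a, ha⟩, ⟨b, hb⟩⟩ := hx
    refine ⟨a, b, (hA x a).2 ha.symm, (hB x b).2 hb.symm, ?_⟩
    apply h.harmonicOp_injective
    rw [← hxy]
    exact key ha.symm hb.symm

end IsCommutingPair

end Pair

end JointCalculus

/-! ### Tensor products of unbounded operators and the product scale -/

section ProductScale

/-- The tensor structure enters only through two commuting representations. All three conclusions
follow once each `X s` is recognised as the range of `m^s`, where `m` is the bounded inverse of `A +
B`. -/
theorem IsOperatorRep.isInterpolationScale_and_isGenerator {H₁ H₂ : Type*} {K : Type u}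
    [NormedAddCommGroup H₁] [InnerProductSpace ℂ H₁] [CompleteSpace H₁]
    [NormedAddCommGroup H₂] [InnerProductSpace ℂ H₂] [CompleteSpace H₂]
    [NormedAddCommGroup K] [InnerProductSpace ℂ K] [CompleteSpace K]
    {f₁ : (H₁ →L[ℂ] H₁) → (K →L[ℂ] K)} {f₂ : (H₂ →L[ℂ] H₂) → (K →L[ℂ] K)}
    (hf₁ : IsOperatorRep f₁) (hf₂ : IsOperatorRep f₂)
    (hcomm : ∀ S T x, f₁ S (f₂ T x) = f₂ T (f₁ S x))
    {P : H₁ →L[ℂ] H₁} {Q : H₂ →L[ℂ] H₂} (hP : 0 ≤ P) (hP1 : ‖P‖ ≤ 1) (hQ : 0 ≤ Q) (hQ1 : ‖Q‖ ≤ 1)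
    {A B : K →ₗ.[ℂ] K} (hA : IsBoundedInverse A (f₁ P)) (hB : IsBoundedInverse B (f₂ Q))
    {X : ℝ≥0 → HilbertSub.{u, v} K}
    (hX : ∀ s : ℝ≥0, (X s).carrier = (f₁ (P ^ (s : ℝ))).range ⊓ (f₂ (Q ^ (s : ℝ))).range) :
    IsInterpolationScale X ∧ IsGenerator (A + B) X ∧ ∀ s t : ℝ≥0,
      (X (s + t)).carrier ≤ (f₁ (P ^ (s : ℝ)) ∘L f₂ (Q ^ (t : ℝ))).range := by
  have hpair : IsCommutingPair (f₁ P) (f₂ Q) :=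
    { left_nonneg := map_nonneg hf₁.hom hP
      right_nonneg := map_nonneg hf₂.hom hQ
      left_norm_le := (NonUnitalStarAlgHom.norm_apply_le hf₁.hom P).trans hP1
      right_norm_le := (NonUnitalStarAlgHom.norm_apply_le hf₂.hom Q).trans hQ1
      left_injective := hA.injective
      right_injective := hB.injective
      commute := ContinuousLinearMap.ext (hcomm P Q) }
  have e₁ : ∀ s : ℝ≥0, f₁ (P ^ (s : ℝ)) = f₁ P ^ (s : ℝ) := fun s =>
    map_rpow_of_nonneg hf₁.hom hP s.coe_nonneg
  have e₂ : ∀ s : ℝ≥0, f₂ (Q ^ (s : ℝ)) = f₂ Q ^ (s : ℝ) := fun s =>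
    map_rpow_of_nonneg hf₂.hom hQ s.coe_nonneg
  have hXm : ∀ s : ℝ≥0, (X s).carrier = (harmonicOp (f₁ P) (f₂ Q) ^ (s : ℝ) : K →L[ℂ] K).range :=
    fun s => by rw [hX, e₁, e₂, hpair.range_rpow_inf_range_rpow s.coe_nonneg]
  have hAB := hpair.isBoundedInverse_add hA hB
  have hsa : IsSelfAdjoint (A + B) := hAB.isSelfAdjoint (.of_nonneg hpair.harmonicOp_nonneg)
  refine ⟨isInterpolationScale_of_carrier_eq hpair.harmonicOp_nonneg hpair.norm_harmonicOp_le
    hpair.harmonicOp_injective hXm, ⟨hsa, fun s => HilbertSub.sameSpace_of_carrier_eq ?_⟩,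
    fun s t => ?_⟩
  · rw [hXm, carrier_sobolevSpace hsa hAB hpair.harmonicOp_nonneg hpair.norm_harmonicOp_le]
  · rw [hXm, e₁, e₂, NNReal.coe_add]
    exact hpair.range_harmonicOp_rpow_le s.coe_nonneg t.coe_nonneg

theorem pow_apply_mem_powDomain {H : Type*} [NormedAddCommGroup H] [InnerProductSpace ℂ H]
    {A : H →ₗ.[ℂ] H} {P : H →L[ℂ] H} (hP : IsBoundedInverse A P) (n : ℕ) (y : H) :
    (P ^ n) y ∈ powDomain A n := by
  induction n with
  | zero => exact Submodule.mem_top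
  | succ n ih =>
    have hg : ((P ^ (n + 1)) y, (P ^ n) y) ∈ A.graph := by
      rw [hP, pow_succ', mul_apply_eq_comp]
    obtain ⟨d, hd, hAd⟩ := (LinearPMap.mem_graph_iff A).1 hg
    refine ⟨d, ?_, hd⟩
    change A d ∈ powDomain A n
    rw [hAd]
    exact ih

theorem mem_smoothDomain_of_forall_mem_range {H : Type*} [NormedAddCommGroup H]
    [InnerProductSpace ℂ H] [CompleteSpace H] {A : H →ₗ.[ℂ] H} {P : H →L[ℂ] H}
    (hP : IsBoundedInverse A P) (hP0 : 0 ≤ P) {x : H}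
    (hx : ∀ s : ℝ≥0, x ∈ (P ^ (s : ℝ) : H →L[ℂ] H).range) : x ∈ smoothDomain A := by
  rw [smoothDomain, Submodule.mem_iInf]
  intro n
  obtain ⟨y, rfl⟩ := hx n
  rw [NNReal.coe_natCast, CFC.rpow_natCast P n hP0]
  exact pow_apply_mem_powDomain hP n y

/-- Supplies graph elements `(P x, x)` with smooth first entry for a dense set of `x`. -/
theorem apply_mem_smoothDomain {H : Type*} [NormedAddCommGroup H] [InnerProductSpace ℂ H]
    [CompleteSpace H] {A : H →ₗ.[ℂ] H} {P : H →L[ℂ] H}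
    (hP : IsBoundedInverse A P) (hP0 : 0 ≤ P) {x : H}
    (hx : ∀ s : ℝ≥0, x ∈ (P ^ (s : ℝ) : H →L[ℂ] H).range) : P x ∈ smoothDomain A := by
  refine mem_smoothDomain_of_forall_mem_range hP hP0 fun s => ?_
  obtain ⟨y, rfl⟩ := hx s
  refine ⟨P y, ?_⟩
  have hc : (P ^ (s : ℝ) : H →L[ℂ] H) * P = P * P ^ (s : ℝ) := by
    have h1 := rpow_add_eq_mul (w := P) s.coe_nonneg zero_le_one
    have h2 := rpow_add_eq_mul (w := P) zero_le_one s.coe_nonneg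
    rw [CFC.rpow_one P hP0] at h1 h2
    rw [← h1, ← h2, add_comm]
  exact DFunLike.congr_fun hc y

variable {H₁ : Type u₁} {H₂ : Type u₂} [NormedAddCommGroup H₁] [InnerProductSpace ℂ H₁]
  [NormedAddCommGroup H₂] [InnerProductSpace ℂ H₂]

theorem algTensorOp_graph_le {A : H₁ →ₗ.[ℂ] H₁} {B : H₂ →ₗ.[ℂ] H₂} {P : H₁ →L[ℂ] H₁}
    {Q : H₂ →L[ℂ] H₂} (hP : IsBoundedInverse A P) (hQ : IsBoundedInverse B Q)
    {x y : HTensor H₁ H₂} (hxy : (x, y) ∈ (algTensorOp A B).graph) : x = hTensorMap P Q y := by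
  obtain ⟨⟨_, u, rfl⟩, rfl, rfl⟩ := (LinearPMap.mem_graph_iff _).1 hxy
  have e : (algTensorOp A B) ⟨algIncl _ _ u, u, rfl⟩ =
      ((TensorProduct.map (A.toFun ∘ₗ Submodule.inclusion (smoothDomain_le A))
        (B.toFun ∘ₗ Submodule.inclusion (smoothDomain_le B)) u : H₁ ⊗[ℂ] H₂) : HTensor H₁ H₂) := by
    have : (LinearEquiv.ofInjective _ (algIncl_injective (smoothDomain A) (smoothDomain B))).symm
        ⟨algIncl _ _ u, u, rfl⟩ = u := by
      rw [LinearEquiv.symm_apply_eq]; rfl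
    change ((TensorProduct.map _ _ ((LinearEquiv.ofInjective _ (algIncl_injective (smoothDomain A)
      (smoothDomain B))).symm ⟨algIncl _ _ u, u, rfl⟩) : H₁ ⊗[ℂ] H₂) : HTensor H₁ H₂) = _
    rw [this]
  refine Eq.trans ?_ (congrArg (hTensorMap P Q) e.symm)
  rw [hTensorMap, ContinuousLinearMap.completion_apply_coe]
  change ((TensorProduct.map (smoothDomain A).subtype (smoothDomain B).subtype u : H₁ ⊗[ℂ] H₂) :
    HTensor H₁ H₂) = _
  congr 1
  rw [TensorProduct.mapL_apply, TensorProduct.map_map]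
  congr 2
  · ext a
    exact (hP _ _).1 (A.mem_graph ⟨a, smoothDomain_le A a.2⟩)
  · ext b
    exact (hQ _ _).1 (B.mem_graph ⟨b, smoothDomain_le B b.2⟩)

theorem hTmul_mem_graph_algTensorOp {A : H₁ →ₗ.[ℂ] H₁} {B : H₂ →ₗ.[ℂ] H₂} {a a' : H₁} {b b' : H₂}
    (ha : a ∈ smoothDomain A) (hb : b ∈ smoothDomain B) (haa : (a, a') ∈ A.graph)
    (hbb : (b, b') ∈ B.graph) : (hTmul a b, hTmul a' b') ∈ (algTensorOp A B).graph := by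
  have ha' := A.mem_graph_snd_inj (A.mem_graph ⟨a, smoothDomain_le A ha⟩) haa rfl
  have hb' := B.mem_graph_snd_inj (B.mem_graph ⟨b, smoothDomain_le B hb⟩) hbb rfl
  let u : smoothDomain A ⊗[ℂ] smoothDomain B := ⟨a, ha⟩ ⊗ₜ[ℂ] ⟨b, hb⟩
  refine (LinearPMap.mem_graph_iff _).2 ⟨⟨algIncl _ _ u, u, rfl⟩, rfl, ?_⟩
  have : (LinearEquiv.ofInjective _ (algIncl_injective (smoothDomain A) (smoothDomain B))).symm
      ⟨algIncl _ _ u, u, rfl⟩ = u := by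
    rw [LinearEquiv.symm_apply_eq]; rfl
  change ((TensorProduct.map _ _ ((LinearEquiv.ofInjective _ (algIncl_injective (smoothDomain A)
    (smoothDomain B))).symm ⟨algIncl _ _ u, u, rfl⟩) : H₁ ⊗[ℂ] H₂) : HTensor H₁ H₂) = _
  rw [this, ← ha', ← hb']
  rfl

/-- The graph of the closure is `Γ`, the set of pairs `(T y, y)`. It is closed and contains the
algebraic graph. Conversely, the `y` with `(T y, y)` in the closed graph form a closed subspace `D`
containing `a ⊗ b` for `a`, `b` in dense sets, so `D` is everything. -/
theorem isBoundedInverse_tensorOp [CompleteSpace H₁] [CompleteSpace H₂] {A : H₁ →ₗ.[ℂ] H₁}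
    {B : H₂ →ₗ.[ℂ] H₂} {P : H₁ →L[ℂ] H₁} {Q : H₂ →L[ℂ] H₂} (hP : IsBoundedInverse A P)
    (hQ : IsBoundedInverse B Q) (hP0 : 0 ≤ P) (hQ0 : 0 ≤ Q) :
    IsBoundedInverse (tensorOp A B) (hTensorMap P Q) := by
  set T := hTensorMap P Q with hT
  have hTinj : Function.Injective T := hTensorMap_injective P Q hP.injective hQ.injective
  let Γ : Submodule ℂ (HTensor H₁ H₂ × HTensor H₁ H₂) :=
    (ContinuousLinearMap.fst ℂ _ _ - T ∘L ContinuousLinearMap.snd ℂ (HTensor H₁ H₂)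
      (HTensor H₁ H₂)).ker
  have hΓ : ∀ x y, (x, y) ∈ Γ ↔ x = T y := fun x y => by
    change x - T y = 0 ↔ _
    exact sub_eq_zero
  have hΓcl : IsClosed (Γ : Set (HTensor H₁ H₂ × HTensor H₁ H₂)) :=
    ContinuousLinearMap.isClosed_ker _
  let φ : HTensor H₁ H₂ →L[ℂ] HTensor H₁ H₂ × HTensor H₁ H₂ := T.prod (.id ℂ _)
  let D : Submodule ℂ (HTensor H₁ H₂) :=
    (algTensorOp A B).graph.topologicalClosure.comap φ.toLinearMap
  have hDcl : IsClosed (D : Set (HTensor H₁ H₂)) :=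
    (Submodule.isClosed_topologicalClosure _).preimage φ.continuous
  have hD : ∀ a b, hTmul a b ∈ D := by
    intro a b
    refine (dense_iInf_range_rpow hP0 hP.injective).induction (P := fun a => hTmul a b ∈ D)
      (fun a ha => ?_) (hDcl.preimage (continuous_hTmul_left b)) a
    refine (dense_iInf_range_rpow hQ0 hQ.injective).induction (P := fun b => hTmul a b ∈ D)
      (fun b hb => ?_) (hDcl.preimage (continuous_hTmul_right a)) b
    refine Submodule.le_topologicalClosure _ ?_
    change (T (hTmul a b), hTmul a b) ∈ (algTensorOp A B).graph
    rw [hT, hTensorMap_hTmul]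
    exact hTmul_mem_graph_algTensorOp (apply_mem_smoothDomain hP hP0 ha)
      (apply_mem_smoothDomain hQ hQ0 hb) ((hP _ _).2 rfl) ((hQ _ _).2 rfl)
  have hDuniv : ∀ y, y ∈ D := fun y => by
    have h1 := dense_of_forall_hTmul_mem fun a b => D.le_topologicalClosure (hD a b)
    have h2 := h1.closure_eq
    rw [hDcl.closure_eq] at h2
    exact h2.ge (Set.mem_univ y)
  have hcl : (algTensorOp A B).graph.topologicalClosure = Γ := by
    apply le_antisymm
    · refine Submodule.topologicalClosure_minimal _ ?_ hΓcl
      rintro ⟨x, y⟩ hxy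
      exact (hΓ x y).2 (algTensorOp_graph_le hP hQ hxy)
    · rintro ⟨x, y⟩ hxy
      rw [(hΓ x y).1 hxy]
      exact hDuniv y
  have hgraph : Γ.toLinearPMap.graph = Γ := by
    refine Submodule.toLinearPMap_graph_eq _ ?_
    intro p hp hp1
    have h0 : p.1 = T p.2 := (hΓ p.1 p.2).1 hp
    exact hTinj (by rw [← h0, hp1, map_zero])
  -- Closability, which rests on injectivity of `T`, has to be proved: for a non-closable operator
  -- `closure` returns the operator itself.
  have hclosable : (algTensorOp A B).IsClosable := ⟨Γ.toLinearPMap, by rw [hcl, hgraph]⟩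
  intro x y
  rw [tensorOp, ← hclosable.graph_closure_eq_closure_graph, hcl, hΓ]

theorem isBoundedInverse_idOp (H : Type u) [NormedAddCommGroup H] [InnerProductSpace ℂ H] :
    IsBoundedInverse (idOp H) 1 := by
  intro x y
  rw [LinearPMap.mem_graph_iff]
  constructor
  · rintro ⟨d, rfl, hd⟩
    exact hd
  · intro h
    exact ⟨⟨y, Submodule.mem_top⟩, h.symm, rfl⟩

end ProductScale

end

theorem propositionp {H₁ : Type u₁} {H₂ : Type u₂}
    [NormedAddCommGroup H₁] [InnerProductSpace ℂ H₁] [CompleteSpace H₁]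
    [NormedAddCommGroup H₂] [InnerProductSpace ℂ H₂] [CompleteSpace H₂]
    (X₁ : ℝ≥0 → HilbertSub.{u₁, v₁} H₁) (X₂ : ℝ≥0 → HilbertSub.{u₂, v₂} H₂)
    (Λ₁ : H₁ →ₗ.[ℂ] H₁) (Λ₂ : H₂ →ₗ.[ℂ] H₂)
    (hΛ₁ : OneLe Λ₁) (hΛ₂ : OneLe Λ₂)
    (hX₁ : IsGenerator Λ₁ X₁) (hX₂ : IsGenerator Λ₂ X₂) :
    IsInterpolationScale (productScale X₁ X₂) ∧
    IsGenerator (tensorSum Λ₁ Λ₂) (productScale X₁ X₂) ∧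
    ∀ s : ℝ≥0,
      (productScale X₁ X₂ s).carrier =
          ⨅ t ∈ Set.Icc 0 s, ((X₁ t).tensor (X₂ (s - t))).carrier ∧
      (productScale X₁ X₂ s).carrier =
          ((X₁ s).tensor (X₂ 0)).carrier ⊓ ((X₁ 0).tensor (X₂ s)).carrier := by
  obtain ⟨hs₁, hX₁⟩ := hX₁
  obtain ⟨hs₂, hX₂⟩ := hX₂
  obtain ⟨P, hP, hP0, hP1⟩ := exists_isBoundedInverse hs₁ hΛ₁
  obtain ⟨Q, hQ, hQ0, hQ1⟩ := exists_isBoundedInverse hs₂ hΛ₂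
  have hc₁ : ∀ s : ℝ≥0, (X₁ s).carrier = (P ^ (s : ℝ) : H₁ →L[ℂ] H₁).range := fun s => by
    rw [(hX₁ s).carrier_eq, carrier_sobolevSpace hs₁ hP hP0 hP1]
  have hc₂ : ∀ s : ℝ≥0, (X₂ s).carrier = (Q ^ (s : ℝ) : H₂ →L[ℂ] H₂).range := fun s => by
    rw [(hX₂ s).carrier_eq, carrier_sobolevSpace hs₂ hQ hQ0 hQ1]
  have ht : ∀ s t : ℝ≥0, ((X₁ s).tensor (X₂ t)).carrier =
      (hTensorMap (P ^ (s : ℝ) : H₁ →L[ℂ] H₁) (Q ^ (t : ℝ) : H₂ →L[ℂ] H₂)).range := fun s t =>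
    carrier_tensor_eq (rpow_injective_of_nonneg hP0 hP.injective s.coe_nonneg)
      (rpow_injective_of_nonneg hQ0 hQ.injective t.coe_nonneg) (hc₁ s) (hc₂ t)
  have hinter : ∀ s : ℝ≥0, (productScale X₁ X₂ s).carrier =
      ((X₁ s).tensor (X₂ 0)).carrier ⊓ ((X₁ 0).tensor (X₂ s)).carrier := fun s =>
    HilbertSub.carrier_inter _ _
  obtain ⟨hscale, hgen, hle⟩ := IsOperatorRep.isInterpolationScale_and_isGenerator
    (isOperatorRep_hTensorMap_left (H₁ := H₁) (H₂ := H₂)) isOperatorRep_hTensorMap_right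
    (fun S T x => by
      rw [← ContinuousLinearMap.comp_apply, ← ContinuousLinearMap.comp_apply, ← hTensorMap_comp,
        ← hTensorMap_comp]
      rfl) hP0 hP1 hQ0 hQ1
    (isBoundedInverse_tensorOp hP (isBoundedInverse_idOp H₂) hP0 zero_le_one)
    (isBoundedInverse_tensorOp (isBoundedInverse_idOp H₁) hQ zero_le_one hQ0)
    (X := productScale X₁ X₂) (fun s => by
      rw [hinter, ht, ht, NNReal.coe_zero, CFC.rpow_zero P hP0, CFC.rpow_zero Q hQ0])
  refine ⟨hscale, hgen, fun s => ⟨le_antisymm ?_ ?_, hinter s⟩⟩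
  · refine le_iInf₂ fun t hts => ?_
    have h1 := hle t (s - t)
    -- The truncated difference satisfies `t + (s - t) = s` because `t ≤ s`.
    rw [add_tsub_cancel_of_le hts.2, ← hTensorMap_comp] at h1
    rw [ht]
    exact h1
  -- The endpoints `t = s` and `t = 0` of the family are already the two spaces being intersected.
  · rw [hinter]
    refine le_inf ?_ ?_
    · have := iInf₂_le (f := fun (t : ℝ≥0) (_ : t ∈ Set.Icc 0 s) =>
        ((X₁ t).tensor (X₂ (s - t))).carrier) s ⟨zero_le, le_rfl⟩
      rwa [tsub_self] at this
    · have := iInf₂_le (f := fun (t : ℝ≥0) (_ : t ∈ Set.Icc 0 s) =>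
        ((X₁ t).tensor (X₂ (s - t))).carrier) 0 ⟨le_rfl, zero_le⟩
      rwa [tsub_zero] at this
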